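/- A convex cone $K \subset \mathbb R^3$ is called regular if it is closed, has non-empty interior, and does not contain a line. Its automorphism group $\operatorname{Aut} K$ is the group of invertible linear maps $g$ of $\mathbb R^3$ with $g[K] = K$, and $\dim \operatorname{Aut} K$ is its dimension as a closed subgroup of $GL(3,\mathbb R)$, i.e., the dimension of its Lie algebra $\{A \mid e^{tA} \in \operatorname{Aut} K \text{ for all } t \in \mathbb R\}$. Two cones $K, L \subset \mathbb R^3$ are called isomorphic if $S[K] = L$ for some invertible linear map $S$ of $\mathbb R^3$. Theorem. Let $K \subset \mathbb R^3$ be a regular convex cone such that $\dim \operatorname{Aut} K \geq 2$. Then $K$ is isomorphic to exactly one of the following cones: 1. the cone obtained by homogenization of the epigraph of the exponential function, $\{(x_1,x_2,0) \mid x_1 \leq 0,\ x_2 \geq 0\} \cup \{(x_1,x_2,x_3) \mid x_3 > 0,\ x_2/x_3 \geq \exp(x_1/x_3)\}$; 2. the positive orthant $\mathbb R_+^3$; 3. the cone $\{x \mid x_2 \leq x_1^{1/p}x_3^{1/q},\ x_1 \geq 0,\ x_3 \geq 0\}$ for some $p \in [2,\infty)$, $\frac1p+\frac1q = 1$; 4.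 the cone $\{x \mid -\alpha x_1^{1/p}x_3^{1/q} \leq x_2 \leq x_1^{1/p}x_3^{1/q},\ x_1 \geq 0,\ x_3 \geq 0\}$ for some $p \in [2,\infty)$, $\frac1p+\frac1q = 1$, $\alpha \in (0,1]$; 5. the cone $\{x \mid 0 \leq x_2 \leq x_1^{1/p}x_3^{1/q},\ x_1 \geq 0,\ x_3 \geq 0\}$ for some $p \in [2,\infty)$, $\frac1p+\frac1q = 1$. Moreover, the listed cones are mutually non-isomorphic: no cone of one family is isomorphic to a cone of another family, and within families 3, 4, 5 cones with different parameters ($p$, respectively the pair $(p,\alpha)$) are not isomorphic. -/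

import Mathlib

open Filter Topology

/-- The space `ℝ³`. The coordinates `x₁, x₂, x₃` of `x` are `x 0, x 1, x 2`. -/
abbrev E3 : Type := EuclideanSpace ℝ (Fin 3)

/-- A regular convex cone: a convex cone which is closed, has non-empty interior, and does not
contain a line. -/
structure IsRegularConvexCone (K : Set E3) : Prop where
  convex : Convex ℝ K
  smul_mem : ∀ c : ℝ, 0 < c → ∀ x ∈ K, c • x ∈ K
  isClosed : IsClosed K
  interior_nonempty : (interior K).Nonempty
  no_line : ¬ ∃ x v : E3, v ≠ 0 ∧ ∀ t : ℝ, x + t • v ∈ K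

/-- Two cones are isomorphic if an invertible linear map of `ℝ³` takes one onto the other. -/
def ConeIsomorphic (K L : Set E3) : Prop :=
  ∃ S : E3 ≃L[ℝ] E3, S '' K = L

/-- The automorphism group of `K`: the invertible linear maps `g` with `g[K] = K`. -/
def coneAut (K : Set E3) : Subgroup (E3 ≃L[ℝ] E3) where
  carrier := {g | g '' K = K}
  one_mem' := by
    change (fun x : E3 => x) '' K = K
    simp
  mul_mem' := by
    intro g h hg hh
    change (fun x => g (h x)) '' K = K
    rw [← Set.image_image g h K, Set.mem_ofPred_eq.mp hh, Set.mem_ofPred_eq.mp hg]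
  inv_mem' := by
    intro g hg
    change g.symm '' K = K
    conv_lhs => rw [← Set.mem_ofPred_eq.mp hg]
    rw [Set.image_image]
    simp

theorem norm_pow_sub_pow_le_of_norm_le {𝔸 : Type*} [NormedRing 𝔸] [NormOneClass 𝔸]
    {X Y : 𝔸} {M : ℝ} (hM : 1 ≤ M) (hX : ‖X‖ ≤ M) (hY : ‖Y‖ ≤ M) (k : ℕ) :
    ‖X ^ k - Y ^ k‖ ≤ k * M ^ k * ‖X - Y‖ := by
  induction k with
  | zero => simp
  | succ k ih =>
    have e : X ^ (k + 1) - Y ^ (k + 1) = X ^ k * (X - Y) + (X ^ k - Y ^ k) * Y := by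
      rw [pow_succ, pow_succ, mul_sub, sub_mul]; abel
    have hXk : ‖X ^ k‖ ≤ M ^ k :=
      (norm_pow_le X k).trans (pow_le_pow_left₀ (norm_nonneg _) hX k)
    have hMk : (0 : ℝ) ≤ M ^ k := by positivity
    rw [e]
    calc ‖X ^ k * (X - Y) + (X ^ k - Y ^ k) * Y‖
        ≤ ‖X ^ k‖ * ‖X - Y‖ + ‖X ^ k - Y ^ k‖ * ‖Y‖ :=
          (norm_add_le _ _).trans (add_le_add (norm_mul_le _ _) (norm_mul_le _ _))
      _ ≤ M ^ k * ‖X - Y‖ + (k * M ^ k * ‖X - Y‖) * M := by gcongr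
      _ ≤ M ^ k * M * ‖X - Y‖ + (k * M ^ k * ‖X - Y‖) * M := by
          have : M ^ k ≤ M ^ k * M := le_mul_of_one_le_right hMk hM
          gcongr
      _ = ((k + 1 : ℕ) : ℝ) * M ^ (k + 1) * ‖X - Y‖ := by push_cast; ring

theorem norm_exp_le_exp_norm {𝔸 : Type*} [NormedRing 𝔸] [NormOneClass 𝔸] [NormedAlgebra ℝ 𝔸]
    [CompleteSpace 𝔸] (C : 𝔸) : ‖NormedSpace.exp C‖ ≤ Real.exp ‖C‖ := by
  have h1 : HasSum (fun n : ℕ => ((n.factorial : ℝ)⁻¹) • C ^ n) (NormedSpace.exp C) :=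
    NormedSpace.exp_series_hasSum_exp' C
  have h2 : HasSum (fun n : ℕ => ((n.factorial : ℝ)⁻¹) • ‖C‖ ^ n) (NormedSpace.exp ‖C‖) :=
    NormedSpace.exp_series_hasSum_exp' ‖C‖
  rw [Real.exp_eq_exp_ℝ]
  refine h1.norm_le_of_bounded h2 fun n => ?_
  rw [norm_smul, Real.norm_of_nonneg (by positivity), smul_eq_mul]
  gcongr
  exact norm_pow_le C n

/-- The Lie product formula. -/
theorem tendsto_exp_mul_exp_pow {𝔸 : Type*} [NormedRing 𝔸] [NormOneClass 𝔸] [NormedAlgebra ℝ 𝔸]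
    [CompleteSpace 𝔸] (A B : 𝔸) :
    Tendsto (fun n : ℕ => (NormedSpace.exp ((1 / ((n : ℝ) + 1)) • A) *
      NormedSpace.exp ((1 / ((n : ℝ) + 1)) • B)) ^ (n + 1)) atTop
      (𝓝 (NormedSpace.exp (A + B))) := by
  let : NormedAlgebra ℚ 𝔸 := NormedAlgebra.restrictScalars ℚ ℝ 𝔸
  have hs : Tendsto (fun n : ℕ => 1 / ((n : ℝ) + 1)) atTop (𝓝 0) :=
    tendsto_one_div_add_atTop_nhds_zero_nat
  have hd : HasDerivAt (fun s : ℝ => NormedSpace.exp (s • A) * NormedSpace.exp (s • B) -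
      NormedSpace.exp (s • (A + B))) 0 0 := by
    have h1 := ((hasDerivAt_exp_smul_const (𝕂 := ℝ) A 0).mul
      (hasDerivAt_exp_smul_const (𝕂 := ℝ) B 0)).sub
      (hasDerivAt_exp_smul_const (𝕂 := ℝ) (A + B) 0)
    simp only [zero_smul, NormedSpace.exp_zero, one_mul, mul_one, sub_self] at h1
    exact h1
  have ho := hasDerivAt_iff_isLittleO_nhds_zero.mp hd
  simp only [zero_add, zero_smul, NormedSpace.exp_zero, mul_one, sub_self, sub_zero,
    smul_zero] at ho
  have hlim := (ho.comp_tendsto hs).norm_left.tendsto_div_nhds_zero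
  simp only [Function.comp_def] at hlim
  rw [tendsto_iff_norm_sub_tendsto_zero]
  have hlim2 := hlim.const_mul (Real.exp (‖A‖ + ‖B‖))
  rw [mul_zero] at hlim2
  refine squeeze_zero (fun _ => norm_nonneg _) (fun n => ?_) hlim2
  have hn : (0 : ℝ) < (n : ℝ) + 1 := by positivity
  have hY : NormedSpace.exp (A + B) =
      NormedSpace.exp ((1 / ((n : ℝ) + 1)) • (A + B)) ^ (n + 1) := by
    rw [← NormedSpace.exp_nsmul, ← Nat.cast_smul_eq_nsmul ℝ, smul_smul]
    congr 1
    push_cast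
    rw [mul_one_div_cancel hn.ne', one_smul]
  set M := Real.exp ((1 / ((n : ℝ) + 1)) * (‖A‖ + ‖B‖)) with hMdef
  have hM : 1 ≤ M := Real.one_le_exp (by positivity)
  have hns : ∀ C : 𝔸, ‖(1 / ((n : ℝ) + 1)) • C‖ = (1 / ((n : ℝ) + 1)) * ‖C‖ := by
    intro C
    rw [norm_smul, Real.norm_of_nonneg (by positivity)]
  have h1 : ‖NormedSpace.exp ((1 / ((n : ℝ) + 1)) • A) *
      NormedSpace.exp ((1 / ((n : ℝ) + 1)) • B)‖ ≤ M := by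
    refine (norm_mul_le _ _).trans ?_
    rw [hMdef, mul_add, Real.exp_add, ← hns, ← hns]
    gcongr <;> exact norm_exp_le_exp_norm _
  have h2 : ‖NormedSpace.exp ((1 / ((n : ℝ) + 1)) • (A + B))‖ ≤ M := by
    refine (norm_exp_le_exp_norm _).trans ?_
    rw [hns, hMdef]
    gcongr
    exact norm_add_le _ _
  have h3 := norm_pow_sub_pow_le_of_norm_le hM h1 h2 (n + 1)
  have hMn : M ^ (n + 1) = Real.exp (‖A‖ + ‖B‖) := by
    rw [hMdef, ← Real.exp_nat_mul]
    congr 1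
    push_cast
    field_simp
  rw [hMn] at h3
  rw [hY]
  refine h3.trans (le_of_eq ?_)
  push_cast
  field_simp

theorem exp_smul_mul_exp_neg_smul {𝔸 : Type*} [NormedRing 𝔸] [NormedAlgebra ℝ 𝔸]
    [CompleteSpace 𝔸] (A : 𝔸) (t : ℝ) :
    NormedSpace.exp (t • A) * NormedSpace.exp ((-t) • A) = 1 := by
  let : NormedAlgebra ℚ 𝔸 := NormedAlgebra.restrictScalars ℚ ℝ 𝔸
  rw [← NormedSpace.exp_add_of_commute (((Commute.refl A).smul_left _).smul_right _), ← add_smul]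
  simp [NormedSpace.exp_zero]

theorem exists_coneAut_eq_exp_iff (K : Set E3) (A : E3 →L[ℝ] E3) :
    (∀ t : ℝ, ∃ g ∈ coneAut K, (g : E3 →L[ℝ] E3) = NormedSpace.exp (t • A)) ↔
      ∀ t : ℝ, ∀ x ∈ K, NormedSpace.exp (t • A) x ∈ K := by
  have hinv : ∀ t : ℝ, (NormedSpace.exp (t • A) : E3 →L[ℝ] E3) *
      (NormedSpace.exp ((-t) • A) : E3 →L[ℝ] E3) = 1 := exp_smul_mul_exp_neg_smul A
  constructor
  · intro h t x hx
    obtain ⟨g, hg, hgt⟩ := h t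
    rw [← hgt]
    have hg' : g '' K = K := hg
    rw [← hg']
    exact ⟨x, hx, rfl⟩
  · intro h t
    have hl : Function.LeftInverse (NormedSpace.exp ((-t) • A) : E3 →L[ℝ] E3)
        (NormedSpace.exp (t • A) : E3 →L[ℝ] E3) := by
      intro x
      have := congrArg (fun f : E3 →L[ℝ] E3 => f x) (hinv (-t))
      simpa using this
    have hr : Function.RightInverse (NormedSpace.exp ((-t) • A) : E3 →L[ℝ] E3)
        (NormedSpace.exp (t • A) : E3 →L[ℝ] E3) := by
      intro x
      have := congrArg (fun f : E3 →L[ℝ] E3 => f x) (hinv t)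
      simpa using this
    refine ⟨ContinuousLinearEquiv.equivOfInverse _ _ hl hr, ?_, rfl⟩
    change (NormedSpace.exp (t • A) : E3 →L[ℝ] E3) '' K = K
    apply Set.Subset.antisymm
    · rintro _ ⟨x, hx, rfl⟩
      exact h t x hx
    · intro x hx
      exact ⟨_, h (-t) x hx, hr x⟩

/-- The Lie algebra of the automorphism group of a closed set `K` (for closed `K` this is a closed
subgroup of `GL(3, ℝ)`): the linear maps `A` such that `exp (t A)` is an automorphism of `K` for
all real `t`. -/
noncomputable def coneAutLie (K : Set E3) (hK : IsClosed K) :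
    Submodule ℝ (E3 →L[ℝ] E3) where
  carrier := {A | ∀ t : ℝ, ∃ g ∈ coneAut K, (g : E3 →L[ℝ] E3) = NormedSpace.exp (t • A)}
  zero_mem' := by
    intro t
    refine ⟨1, one_mem _, ?_⟩
    rw [smul_zero, NormedSpace.exp_zero]
    rfl
  smul_mem' := by
    intro c A hA t
    rw [smul_smul]
    exact hA (t * c)
  add_mem' := by
    intro A B hA hB
    rw [Set.mem_ofPred_eq, exists_coneAut_eq_exp_iff] at hA hB ⊢
    intro t x hx
    rw [smul_add]
    have hlim := tendsto_exp_mul_exp_pow (t • A) (t • B)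
    have hlimx : Tendsto (fun n : ℕ => ((NormedSpace.exp ((1 / ((n : ℝ) + 1)) • t • A) *
      NormedSpace.exp ((1 / ((n : ℝ) + 1)) • t • B)) ^ (n + 1)) x) atTop
      (𝓝 (NormedSpace.exp (t • A + t • B) x)) :=
      ((ContinuousLinearMap.apply ℝ E3 x).continuous.tendsto _).comp hlim
    refine hK.mem_of_tendsto hlimx (Eventually.of_forall fun n => ?_)
    have hstep : ∀ y ∈ K, (NormedSpace.exp ((1 / ((n : ℝ) + 1)) • t • A) *
        NormedSpace.exp ((1 / ((n : ℝ) + 1)) • t • B)) y ∈ K := by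
      intro y hy
      rw [smul_smul, smul_smul]
      exact hA _ _ (hB _ _ hy)
    have hpow : ∀ k : ℕ, ∀ y ∈ K, ((NormedSpace.exp ((1 / ((n : ℝ) + 1)) • t • A) *
        NormedSpace.exp ((1 / ((n : ℝ) + 1)) • t • B)) ^ k) y ∈ K := by
      intro k
      induction k with
      | zero => intro y hy; simpa using hy
      | succ k ih =>
        intro y hy
        rw [pow_succ]
        exact ih _ (hstep y hy)
    exact hpow _ x hx

/-- The dimension of the automorphism group of a closed set, as a Lie group. -/
noncomputable def coneAutDim (K : Set E3) (hK : IsClosed K) : ℕ :=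
  Module.finrank ℝ (coneAutLie K hK)

/-- The cone obtained by homogenization of the epigraph of the exponential function (the closed
cone spanned by the points `(s, r, 1)` with `r ≥ exp s`). -/
def expEpigraphCone : Set E3 :=
  {x | x 0 ≤ 0 ∧ 0 ≤ x 1 ∧ x 2 = 0} ∪ {x | Real.exp (x 0 / x 2) ≤ x 1 / x 2 ∧ 0 < x 2}

/-- The positive orthant. -/
def orthantCone : Set E3 :=
  {x | 0 ≤ x 0 ∧ 0 ≤ x 1 ∧ 0 ≤ x 2}

/-- The cone `x₂ ≤ x₁^(1/p) x₃^(1/q)`, `x₁, x₃ ≥ 0`. -/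
def powerHypographCone (p q : ℝ) : Set E3 :=
  {x | x 1 ≤ x 0 ^ (1 / p) * x 2 ^ (1 / q) ∧ 0 ≤ x 0 ∧ 0 ≤ x 2}

/-- The cone `-α x₁^(1/p) x₃^(1/q) ≤ x₂ ≤ x₁^(1/p) x₃^(1/q)`, `x₁, x₃ ≥ 0`. -/
def powerCone (p q α : ℝ) : Set E3 :=
  {x | -α * (x 0 ^ (1 / p) * x 2 ^ (1 / q)) ≤ x 1 ∧ x 1 ≤ x 0 ^ (1 / p) * x 2 ^ (1 / q) ∧
    0 ≤ x 0 ∧ 0 ≤ x 2}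

/-- The cone `0 ≤ x₂ ≤ x₁^(1/p) x₃^(1/q)`, `x₁, x₃ ≥ 0`. -/
def halfPowerCone (p q : ℝ) : Set E3 :=
  {x | 0 ≤ x 1 ∧ x 1 ≤ x 0 ^ (1 / p) * x 2 ^ (1 / q) ∧ 0 ≤ x 0 ∧ 0 ≤ x 2}

/-- The entries of the list of cones: five families, with their admissible parameter values. -/
inductive ConeType : Type
  | expEpigraph : ConeType
  | orthant : ConeType
  | powerHypograph (p q : ℝ) (hp : 2 ≤ p) (hpq : 1 / p + 1 / q = 1) : ConeType
  | power (p q α : ℝ) (hp : 2 ≤ p) (hpq : 1 / p + 1 / q = 1) (hα : 0 < α) (hα' : α ≤ 1) : ConeType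
  | halfPower (p q : ℝ) (hp : 2 ≤ p) (hpq : 1 / p + 1 / q = 1) : ConeType

/-- The cone described by an entry of the list. -/
def ConeType.cone : ConeType → Set E3
  | .expEpigraph => expEpigraphCone
  | .orthant => orthantCone
  | .powerHypograph p q _ _ => powerHypographCone p q
  | .power p q α _ _ _ _ => powerCone p q α
  | .halfPower p q _ _ => halfPowerCone p q

/-! Existence. Scalars always lie in the Lie algebra of the automorphism group, so dimension at
least two yields a non-scalar element `A`. Adding a scalar, rescaling and choosing a real basis
bring `A` to one of five shapes: a nilpotent Jordan block of size three, a rotation plus a real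
eigenvalue, a 2×2 Jordan block plus a simple eigenvalue, a rank-one projection, or `diag(1, θ, 0)`
with `0 < θ ≤ 1/2`. A nonzero `A` with `A² = 0` is impossible, because its orbits are lines.

In each shape the same mechanism determines `K`. Rescaled limits of the flow `exp(tA)` stay in the
closed cone and put suitable axis vectors into it. Flow and positive scaling then carry a generic
point to a fixed line, and the cone meets that line in a half-line or a segment, whose ends
(`exists_max`) are the only free parameters. A change of basis absorbs these ends, up to the ratio
`α`. The first two shapes give the quadratic cone `b² ≤ ac` (`p = 2`, `α = 1`), the third the
exponential cone, the fourth the orthant, and the last the orthant or a power cone with `θ = 1/p`.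
`exists_listed` assembles the cases.

Uniqueness. An isomorphism of cones conjugates the linear vector fields tangent to them. For a power
cone other than the quadratic one, the tangency condition along the boundary curve `(u, βu^θ, 1)`,
with `u = exp t`, is a vanishing sum of exponentials. It forces every tangent field to be diagonal
with middle entry the `θ`-weighted mean of the outer ones (`IsRigid`). An isomorphism onto such a
cone therefore respects the coordinate axes up to exchanging the outer two, preserves `θ`, and
scales the interval of values of `x₂ / (x₁^θ x₃^(1-θ))` (`HasProfile.eq_of_image`); the listed
intervals are not multiples of each other. The exponential cone has a tangent field that is not
diagonalizable. The quadratic cone has too many tangent fields to be rigid, but it is strictly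
convex, whereas the orthant and the exponential cone have two-dimensional faces. -/

/-! ### Adapted bases of `ℝ³` -/

/-- Three vectors of `ℝ³` are independent, in elementary form. -/
def Indep3 (u v w : E3) : Prop :=
  ∀ a b c : ℝ, a • u + b • v + c • w = 0 → a = 0 ∧ b = 0 ∧ c = 0

namespace Indep3

variable {u v w : E3}

theorem linearIndependent (h : Indep3 u v w) : LinearIndependent ℝ ![u, v, w] := by
  rw [Fintype.linearIndependent_iff]
  intro g hg
  simp only [Fin.sum_univ_three, Matrix.cons_val_zero, Matrix.cons_val_one,
    Matrix.cons_val_two] at hg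
  obtain ⟨h0, h1, h2⟩ := h _ _ _ hg
  intro i
  fin_cases i <;> assumption

theorem exists_basis (h : Indep3 u v w) :
    ∃ b : Module.Basis (Fin 3) ℝ E3, b 0 = u ∧ b 1 = v ∧ b 2 = w := by
  refine ⟨basisOfLinearIndependentOfCardEqFinrank h.linearIndependent (by simp), ?_, ?_, ?_⟩ <;>
    simp

theorem exists_eq (h : Indep3 u v w) (x : E3) : ∃ a b c : ℝ, x = a • u + b • v + c • w := by
  obtain ⟨b, rfl, rfl, rfl⟩ := h.exists_basis
  refine ⟨b.repr x 0, b.repr x 1, b.repr x 2, ?_⟩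
  rw [← Fin.sum_univ_three (fun i => b.repr x i • b i), b.sum_repr]

theorem ext (h : Indep3 u v w) {a b c a' b' c' : ℝ}
    (e : a • u + b • v + c • w = a' • u + b' • v + c' • w) : a = a' ∧ b = b' ∧ c = c' := by
  have := h (a - a') (b - b') (c - c') (by linear_combination (norm := module) e)
  exact ⟨sub_eq_zero.1 this.1, sub_eq_zero.1 this.2.1, sub_eq_zero.1 this.2.2⟩

theorem swap01 (h : Indep3 u v w) : Indep3 v u w := fun a b c e => by
  have := h b a c (by rw [← e]; abel)
  tauto

theorem swap12 (h : Indep3 u v w) : Indep3 u w v := fun a b c e => by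
  have := h a c b (by rw [← e]; abel)
  tauto

theorem swap02 (h : Indep3 u v w) : Indep3 w v u := h.swap01.swap12.swap01

theorem smul (h : Indep3 u v w) {r s t : ℝ} (hr : r ≠ 0) (hs : s ≠ 0) (ht : t ≠ 0) :
    Indep3 (r • u) (s • v) (t • w) := fun a b c e => by
  have := h (a * r) (b * s) (c * t) (by simpa only [mul_smul] using e)
  simpa [hr, hs, ht] using this

theorem neg0 (h : Indep3 u v w) : Indep3 (-u) v w := by
  simpa using h.smul (r := -1) (s := 1) (t := 1) (by norm_num) (by norm_num) (by norm_num)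

theorem neg1 (h : Indep3 u v w) : Indep3 u (-v) w := h.swap01.neg0.swap01

theorem neg2 (h : Indep3 u v w) : Indep3 u v (-w) := h.swap02.neg0.swap02

/-- A cone given by its membership condition in an adapted basis. -/
theorem coneIsomorphic (h : Indep3 u v w) {K L : Set E3}
    (hKL : ∀ a b c : ℝ, a • u + b • v + c • w ∈ K ↔ !₂[a, b, c] ∈ L) : ConeIsomorphic K L := by
  obtain ⟨b, rfl, rfl, rfl⟩ := h.exists_basis
  have key : ∀ x : E3, b.equivFun.symm (WithLp.ofLp x) ∈ K ↔ x ∈ L := by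
    intro x
    rw [b.equivFun_symm_apply, Fin.sum_univ_three, hKL]
    have : x = !₂[x 0, x 1, x 2] := by ext i; fin_cases i <;> rfl
    rw [← this]
  refine ⟨(b.equivFun.trans (WithLp.linearEquiv 2 ℝ (Fin 3 → ℝ)).symm).toContinuousLinearEquiv, ?_⟩
  ext x
  rw [← key x]
  constructor
  · rintro ⟨y, hy, rfl⟩
    simpa using hy
  · intro hx
    refine ⟨_, hx, ?_⟩
    change (WithLp.linearEquiv 2 ℝ (Fin 3 → ℝ)).symm (b.equivFun (b.equivFun.symm x.ofLp)) = x
    rw [LinearEquiv.apply_symm_apply]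
    rfl

end Indep3

/-! ### Elementary properties of regular cones -/

namespace IsRegularConvexCone

variable {K : Set E3}

theorem nonempty (hK : IsRegularConvexCone K) : K.Nonempty :=
  hK.interior_nonempty.mono interior_subset

theorem zero_mem (hK : IsRegularConvexCone K) : (0 : E3) ∈ K := by
  obtain ⟨x, hx⟩ := hK.nonempty
  have h : Tendsto (fun c : ℝ => c • x) (𝓝[>] 0) (𝓝 ((0 : ℝ) • x)) :=
    ((continuous_id.smul continuous_const).tendsto 0).mono_left nhdsWithin_le_nhds
  rw [zero_smul] at h
  exact hK.isClosed.mem_of_tendsto h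
    (eventually_mem_nhdsWithin.mono fun c hc => hK.smul_mem c hc x hx)

theorem smul_mem' (hK : IsRegularConvexCone K) {c : ℝ} (hc : 0 ≤ c) {x : E3} (hx : x ∈ K) :
    c • x ∈ K := by
  rcases hc.eq_or_lt with rfl | hc
  · rw [zero_smul]; exact hK.zero_mem
  · exact hK.smul_mem c hc x hx

theorem smul_mem_iff (hK : IsRegularConvexCone K) {c : ℝ} (hc : 0 < c) {x : E3} :
    c • x ∈ K ↔ x ∈ K := by
  refine ⟨fun h => ?_, hK.smul_mem c hc x⟩
  have := hK.smul_mem c⁻¹ (inv_pos.2 hc) _ h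
  rwa [inv_smul_smul₀ hc.ne'] at this

theorem add_mem (hK : IsRegularConvexCone K) {x y : E3} (hx : x ∈ K) (hy : y ∈ K) : x + y ∈ K := by
  have := hK.convex hx hy (a := 1 / 2) (b := 1 / 2) (by norm_num) (by norm_num) (by norm_num)
  rw [← smul_add] at this
  exact (hK.smul_mem_iff (by norm_num)).1 this

theorem eq_zero_of_neg_mem (hK : IsRegularConvexCone K) {x : E3} (hx : x ∈ K) (hx' : -x ∈ K) :
    x = 0 := by
  by_contra hne
  refine hK.no_line ⟨0, x, hne, fun t => ?_⟩
  rw [zero_add]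
  rcases le_total 0 t with ht | ht
  · exact hK.smul_mem' ht hx
  · simpa using hK.smul_mem' (neg_nonneg.2 ht) hx'

/-- A multiple of a nonzero vector of the cone which lies in the cone is a nonnegative multiple. -/
theorem nonneg_of_smul_mem (hK : IsRegularConvexCone K) {u : E3} (hu : u ∈ K) (hu0 : u ≠ 0) {a : ℝ}
    (ha : a • u ∈ K) : 0 ≤ a := by
  by_contra hlt
  push Not at hlt
  refine hu0 (hK.eq_zero_of_neg_mem hu ?_)
  refine (hK.smul_mem_iff (neg_pos.2 hlt)).1 ?_
  simpa using ha

/-- A proper subspace has empty interior, so it cannot contain the cone. -/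
theorem exists_notMem (hK : IsRegularConvexCone K) {p : Submodule ℝ E3} (hp : p ≠ ⊤) :
    ∃ x ∈ K, x ∉ p := by
  by_contra! h
  exact hp (p.eq_top_of_nonempty_interior' (hK.interior_nonempty.mono (interior_mono h)))

/-- No coordinate vanishes identically on a cone with interior. Applied to permuted bases, this
supplies the points from which limits of flows are taken. -/
theorem exists_coord_ne_zero (hK : IsRegularConvexCone K) {u v w : E3} (h : Indep3 u v w) :
    ∃ a b c : ℝ, a ≠ 0 ∧ a • u + b • v + c • w ∈ K := by
  have hp : Submodule.span ℝ {v, w} ≠ ⊤ := by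
    intro e
    have hu : u ∈ Submodule.span ℝ {v, w} := e ▸ Submodule.mem_top
    obtain ⟨b, c, hbc⟩ := Submodule.mem_span_pair.1 hu
    have := h (-1) b c (by rw [← hbc]; module)
    norm_num at this
  obtain ⟨x, hx, hxp⟩ := hK.exists_notMem hp
  obtain ⟨a, b, c, rfl⟩ := h.exists_eq x
  refine ⟨a, b, c, fun ha => hxp ?_, hx⟩
  rw [ha, zero_smul, zero_add]
  exact Submodule.mem_span_pair.2 ⟨b, c, rfl⟩

end IsRegularConvexCone

theorem Indep3.ne_zero {u v w : E3} (h : Indep3 u v w) : u ≠ 0 := by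
  rintro rfl
  have := h 1 0 0 (by simp)
  norm_num at this

/-! ### Linear flows and the Lie algebra of the cone -/

/-- Uniqueness for the linear equation `y' = A y`: the curve `exp(-sA) y(s)` has zero derivative.
Explicit solutions can thus replace the operator exponential everywhere below. -/
theorem exp_smul_apply_eq {A : E3 →L[ℝ] E3} {y : ℝ → E3} (hy : ∀ t, HasDerivAt y (A (y t)) t)
    (t : ℝ) : NormedSpace.exp (t • A) (y 0) = y t := by
  have hd : ∀ s : ℝ, HasDerivAt (fun s : ℝ => (NormedSpace.exp ((-s) • A) : E3 →L[ℝ] E3) (y s)) 0 s := by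
    intro s
    have h1 : HasDerivAt (fun s : ℝ => (NormedSpace.exp ((-s) • A) : E3 →L[ℝ] E3))
        ((-1 : ℝ) • (NormedSpace.exp (-s • A) * A)) s :=
      (hasDerivAt_exp_smul_const (𝕂 := ℝ) A (-s)).scomp s (hasDerivAt_neg s)
    refine (h1.clm_apply (hy s)).congr_deriv ?_
    simp
  have hconst : ∀ s, (NormedSpace.exp ((-s) • A) : E3 →L[ℝ] E3) (y s) = y 0 := by
    intro s
    have := is_const_of_deriv_eq_zero (fun s => (hd s).differentiableAt) (fun s => (hd s).deriv) s 0
    have e : (-(0 : ℝ)) • A = 0 := by rw [neg_zero]; exact zero_smul ℝ A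
    rw [this, e, NormedSpace.exp_zero]
    rfl
  rw [← hconst t]
  exact congrArg (fun f : E3 →L[ℝ] E3 => f (y t)) (exp_smul_mul_exp_neg_smul A t)

section Lie

variable {K : Set E3} {hc : IsClosed K}

theorem mem_coneAutLie_iff {A : E3 →L[ℝ] E3} :
    A ∈ coneAutLie K hc ↔ ∀ t : ℝ, ∀ x ∈ K, NormedSpace.exp (t • A) x ∈ K :=
  exists_coneAut_eq_exp_iff K A

/-- The cone is invariant under the flow of an element of its Lie algebra. -/
theorem flow_mem {A : E3 →L[ℝ] E3} (hA : A ∈ coneAutLie K hc) {y : ℝ → E3}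
    (hy : ∀ t, HasDerivAt y (A (y t)) t) (h0 : y 0 ∈ K) (t : ℝ) : y t ∈ K := by
  rw [← exp_smul_apply_eq hy]
  exact mem_coneAutLie_iff.1 hA t _ h0

theorem one_mem_coneAutLie (hK : IsRegularConvexCone K) : 1 ∈ coneAutLie K hc := by
  rw [mem_coneAutLie_iff]
  intro t x hx
  have hy : ∀ t : ℝ, HasDerivAt (fun t : ℝ => Real.exp t • x)
      ((1 : E3 →L[ℝ] E3) (Real.exp t • x)) t := fun t => by
    simpa using (Real.hasDerivAt_exp t).smul_const x
  have := exp_smul_apply_eq hy t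
  simp only [Real.exp_zero, one_smul] at this
  rw [this]
  exact hK.smul_mem _ (Real.exp_pos t) x hx

/-- If all elements were scalar, the Lie algebra would lie in the line spanned by the identity. -/
theorem exists_nonscalar_of_two_le (h : 2 ≤ coneAutDim K hc) :
    ∃ A ∈ coneAutLie K hc, ∀ r : ℝ, A ≠ r • 1 := by
  by_contra! hcon
  have hle : coneAutLie K hc ≤ Submodule.span ℝ {1} := fun A hA =>
    let ⟨r, hr⟩ := hcon A hA
    Submodule.mem_span_singleton.2 ⟨r, hr.symm⟩
  have h1 := Submodule.finrank_mono hle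
  have h2 := finrank_span_singleton (K := ℝ) (one_ne_zero (α := E3 →L[ℝ] E3))
  unfold coneAutDim at h
  omega

/-- The flow of `A` on a combination of three vectors. -/
theorem flow_comb_mem {A : E3 →L[ℝ] E3} (hA : A ∈ coneAutLie K hc) {u v w : E3}
    {f g h f' g' h' : ℝ → ℝ} (hf : ∀ t, HasDerivAt f (f' t) t) (hg : ∀ t, HasDerivAt g (g' t) t)
    (hh : ∀ t, HasDerivAt h (h' t) t)
    (e : ∀ t, A (f t • u + g t • v + h t • w) = f' t • u + g' t • v + h' t • w)
    (h0 : f 0 • u + g 0 • v + h 0 • w ∈ K) (t : ℝ) : f t • u + g t • v + h t • w ∈ K := by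
  refine flow_mem hA (y := fun t => f t • u + g t • v + h t • w) (fun t => ?_) h0 t
  rw [e]
  exact (((hf t).smul_const u).add ((hg t).smul_const v)).add ((hh t).smul_const w)

end Lie

theorem tendsto_comb {u v w : E3} {l : Filter ℝ} {f g h : ℝ → ℝ} {a b c : ℝ}
    (hf : Tendsto f l (𝓝 a)) (hg : Tendsto g l (𝓝 b)) (hh : Tendsto h l (𝓝 c)) :
    Tendsto (fun t => f t • u + g t • v + h t • w) l (𝓝 (a • u + b • v + c • w)) :=
  ((hf.smul_const u).add (hg.smul_const v)).add (hh.smul_const w)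

/-! ### The quadratic cone as the case `p = q = 2`, `α = 1` -/

theorem mem_powerCone_two_iff (x : E3) :
    x ∈ powerCone 2 2 1 ↔ 0 ≤ x 0 ∧ 0 ≤ x 2 ∧ x 1 ^ 2 ≤ x 0 * x 2 := by
  change -1 * (x 0 ^ ((1 : ℝ) / 2) * x 2 ^ ((1 : ℝ) / 2)) ≤ x 1 ∧
    x 1 ≤ x 0 ^ ((1 : ℝ) / 2) * x 2 ^ ((1 : ℝ) / 2) ∧ 0 ≤ x 0 ∧ 0 ≤ x 2 ↔ _
  have key : 0 ≤ x 0 → 0 ≤ x 2 → (x 1 ^ 2 ≤ x 0 * x 2 ↔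
      -1 * (x 0 ^ ((1 : ℝ) / 2) * x 2 ^ ((1 : ℝ) / 2)) ≤ x 1 ∧
      x 1 ≤ x 0 ^ ((1 : ℝ) / 2) * x 2 ^ ((1 : ℝ) / 2)) := by
    intro ha hc
    rw [← Real.mul_rpow ha hc, ← Real.sqrt_eq_rpow, Real.sq_le (mul_nonneg ha hc), neg_one_mul]
  constructor
  · rintro ⟨h1, h2, ha, hc⟩
    exact ⟨ha, hc, (key ha hc).2 ⟨h1, h2⟩⟩
  · rintro ⟨ha, hc, hb⟩
    have := (key ha hc).1 hb
    tauto

theorem listed_of_quadratic {K : Set E3} {u v w : E3} (h : Indep3 u v w)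
    (hq : ∀ a b c : ℝ, a • u + b • v + c • w ∈ K ↔ 0 ≤ a ∧ 0 ≤ c ∧ b ^ 2 ≤ a * c) :
    ∃ T : ConeType, ConeIsomorphic K T.cone := by
  refine ⟨.power 2 2 1 le_rfl (by norm_num) one_pos le_rfl, h.coneIsomorphic fun a b c => ?_⟩
  rw [hq]
  exact (mem_powerCone_two_iff !₂[a, b, c]).symm

/-! ### Recession directions and last points on lines -/

namespace IsRegularConvexCone

variable {K : Set E3}

theorem limit_zero_mem (hK : IsRegularConvexCone K) {F : ℝ → E3} (hF : Continuous F)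
    (h : ∀ s, 0 < s → F s ∈ K) : F 0 ∈ K :=
  hK.isClosed.mem_of_tendsto ((hF.tendsto 0).mono_left nhdsWithin_le_nhds)
    (eventually_mem_nhdsWithin.mono h : ∀ᶠ s in 𝓝[>] (0 : ℝ), F s ∈ K)

/-- Multiplying `x + s⁻¹u` by `s` gives `s x + u`, which tends to `u` as `s → 0`. -/
theorem mem_of_forall_add_smul_mem (hK : IsRegularConvexCone K) {x u : E3}
    (h : ∀ s : ℝ, 0 < s → x + s • u ∈ K) : u ∈ K := by
  have := hK.limit_zero_mem (F := fun s => s • x + u) (by fun_prop) fun s hs => by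
    have := hK.smul_mem s hs _ (h s⁻¹ (inv_pos.2 hs))
    rwa [smul_add, smul_inv_smul₀ hs.ne'] at this
  simpa using this

/-- On a line whose direction is not in the cone, there is a last point of the cone. -/
theorem exists_max (hK : IsRegularConvexCone K) {u w : E3} (hu : u ∉ K)
    (hne : ∃ c : ℝ, c • u + w ∈ K) :
    ∃ c₀ : ℝ, c₀ • u + w ∈ K ∧ ∀ c : ℝ, c • u + w ∈ K → c ≤ c₀ := by
  obtain ⟨c₁, hc₁⟩ := hne
  set C : Set ℝ := {c | c • u + w ∈ K} with hC
  have hclosed : IsClosed C := hK.isClosed.preimage (by fun_prop : Continuous fun c : ℝ => c • u + w)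
  have hbdd : BddAbove C := by
    by_contra hb
    rw [not_bddAbove_iff] at hb
    refine hu (hK.mem_of_forall_add_smul_mem (x := c₁ • u + w) fun s hs => ?_)
    obtain ⟨c, hc, hlt⟩ := hb (c₁ + s)
    have hd : 0 < c - c₁ := by linarith
    -- An unbounded section contains some `c` beyond `c₁ + s`; convexity then puts `c₁ + s` in the
    -- section, for every `s > 0`, so `u` would be a recession direction.
    have h1 := hK.convex hc₁ hc (a := (c - c₁ - s) / (c - c₁)) (b := s / (c - c₁))
      (div_nonneg (by linarith) hd.le) (by positivity) (by field_simp; ring)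
    convert h1 using 1
    match_scalars <;> field_simp <;> ring
  exact ⟨sSup C, hclosed.csSup_mem ⟨c₁, hc₁⟩ hbdd, fun c hc => le_csSup hbdd hc⟩

variable {hc : IsClosed K} {A : E3 →L[ℝ] E3}

/-- The orbit of `x` is the line `x + t A x`, which a regular cone cannot contain. -/
theorem eq_zero_of_sq_eq_zero (hK : IsRegularConvexCone K) (hA : A ∈ coneAutLie K hc)
    (h2 : ∀ x, A (A x) = 0) : A = 0 := by
  by_contra hne
  have hp : LinearMap.ker (A : E3 →ₗ[ℝ] E3) ≠ ⊤ := by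
    intro e
    refine hne (ContinuousLinearMap.ext fun x => ?_)
    exact (e ▸ Submodule.mem_top : x ∈ LinearMap.ker (A : E3 →ₗ[ℝ] E3))
  obtain ⟨x, hx, hxA⟩ := hK.exists_notMem hp
  refine hK.no_line ⟨x, A x, hxA, fun t => ?_⟩
  refine flow_mem hA (y := fun t => x + t • A x) (fun t => ?_) (by simpa using hx) t
  simpa [h2] using ((hasDerivAt_id t).smul_const (A x)).const_add x

/-! ### Nilpotent Jordan block of size three: the quadratic cone -/

section Nilpotent

variable {u v w : E3}

theorem nilpotent_flow (hA : A ∈ coneAutLie K hc) (hu : A u = 0) (hv : A v = u)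
    (hw : A w = v) (t : ℝ) {x y z : ℝ} (hx : x • u + y • v + z • w ∈ K) :
    (x + t * y + t ^ 2 / 2 * z) • u + (y + t * z) • v + z • w ∈ K := by
  refine flow_comb_mem hA (f := fun t => x + t * y + t ^ 2 / 2 * z) (g := fun t => y + t * z)
    (h := fun _ => z) (f' := fun t => y + t * z) (g' := fun _ => z) (h' := fun _ => 0)
    (fun t => ?_) (fun t => ?_) (fun t => hasDerivAt_const _ _) (fun t => ?_) (by simpa using hx) t
  · have := (((hasDerivAt_id t).mul_const y).const_add x).add
      ((((hasDerivAt_id t).pow 2).div_const 2).mul_const z)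
    refine this.congr_deriv ?_
    simp
  · simpa using ((hasDerivAt_id t).mul_const z).const_add y
  · simp [hu, hv, hw]

theorem listed_of_nilpotent_aux (hK : IsRegularConvexCone K) (hA : A ∈ coneAutLie K hc)
    (h : Indep3 u v w) (hu : A u = 0) (hv : A v = u) (hw : A w = v) (huK : u ∈ K)
    (hz : ∀ {x y z : ℝ}, x • u + y • v + z • w ∈ K → 0 ≤ z) :
    ∃ T : ConeType, ConeIsomorphic K T.cone := by
  have fl := fun (t : ℝ) {x y z : ℝ} => nilpotent_flow (x := x) (y := y) (z := z) hA hu hv hw t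
  have hu0 : u ≠ 0 := h.ne_zero
  -- In the plane `z = 0` the flow translates by `t y` along `u`. Letting `t` run to both infinities
  -- puts `y u` and `-y u` in the cone, so `y = 0`.
  have hz0 : ∀ {x y : ℝ}, x • u + y • v + (0 : ℝ) • w ∈ K → y = 0 ∧ 0 ≤ x := by
    intro x y hx
    have h1 : y • u ∈ K := by
      refine hK.mem_of_forall_add_smul_mem (x := x • u + y • v) fun s hs => ?_
      convert fl s hx using 1
      module
    have h2 : (-y) • u ∈ K := by
      refine hK.mem_of_forall_add_smul_mem (x := x • u + y • v) fun s hs => ?_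
      convert fl (-s) hx using 1
      module
    have h3 := hK.nonneg_of_smul_mem huK hu0 h1
    have h4 := hK.nonneg_of_smul_mem huK hu0 h2
    have hy : y = 0 := by linarith
    subst hy
    refine ⟨rfl, hK.nonneg_of_smul_mem huK hu0 (a := x) ?_⟩
    convert hx using 1
    module
  have hnu : -u ∉ K := fun hn => hu0 (hK.eq_zero_of_neg_mem huK hn)
  -- Flow time `-y/z` removes the `v`-coordinate; dividing by `z` leaves the orbit invariant `x/z -
  -- y²/(2z²)`.
  have hred : ∀ {x y z : ℝ}, 0 < z → (x • u + y • v + z • w ∈ K ↔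
      (-(x / z - y ^ 2 / (2 * z ^ 2))) • (-u) + w ∈ K) := by
    intro x y z hz
    constructor
    · intro hx
      have h1 := hK.smul_mem z⁻¹ (inv_pos.2 hz) _ (fl (-y / z) hx)
      convert h1 using 1
      match_scalars <;> field_simp <;> ring
    · intro hx
      have hx' : (x / z - y ^ 2 / (2 * z ^ 2)) • u + (0 : ℝ) • v + (1 : ℝ) • w ∈ K := by
        convert hx using 1; module
      have h1 := hK.smul_mem z hz _ (fl (y / z) hx')
      convert h1 using 1
      match_scalars <;> field_simp <;> ring
  obtain ⟨z, y, x, hzne, hx⟩ := hK.exists_coord_ne_zero h.swap02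
  have hx : x • u + y • v + z • w ∈ K := by convert hx using 1; module
  have hzpos : 0 < z := lt_of_le_of_ne (hz hx) hzne.symm
  obtain ⟨c₀, hc₀, hmax⟩ := hK.exists_max hnu ⟨_, (hred hzpos).1 hx⟩
  have hiff : ∀ c : ℝ, c • (-u) + w ∈ K ↔ c ≤ c₀ := fun c => ⟨hmax c, fun hle => by
    have := hK.add_mem hc₀ (hK.smul_mem' (sub_nonneg.2 hle) huK)
    convert this using 1
    module⟩
  -- In this basis the condition `x/z - y²/(2z²) ≥ -c₀` becomes `b² ≤ ac`.
  have hI : Indep3 ((1 / 2 : ℝ) • u) v (w + (-c₀) • u) := by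
    intro a b c e
    have := h (a / 2 - c * c₀) b c (by rw [← e]; module)
    refine ⟨?_, this.2.1, this.2.2⟩
    have h1 := this.1
    rw [this.2.2] at h1
    linarith
  refine listed_of_quadratic hI fun a b c => ?_
  have e : a • ((1 / 2 : ℝ) • u) + b • v + c • (w + (-c₀) • u) =
      (a / 2 - c * c₀) • u + b • v + c • w := by module
  rw [e]
  rcases lt_trichotomy c 0 with hneg | rfl | hpos
  · refine iff_of_false (fun hm => ?_) (fun hm => ?_)
    · linarith [hz hm]
    · linarith [hm.2.1]
  · constructor
    · intro hm
      obtain ⟨rfl, h2⟩ := hz0 hm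
      refine ⟨by linarith, le_rfl, by simp⟩
    · rintro ⟨h1, -, h2⟩
      have hb : b = 0 := by nlinarith
      subst hb
      have := hK.smul_mem' (c := a / 2) (by linarith) huK
      convert this using 1
      module
  · rw [hred hpos, hiff]
    have e2 : c₀ - (-((a / 2 - c * c₀) / c - b ^ 2 / (2 * c ^ 2))) =
        (a * c - b ^ 2) / (2 * c ^ 2) := by field_simp; ring
    rw [← sub_nonneg, e2]
    have e3 : 0 ≤ (a * c - b ^ 2) / (2 * c ^ 2) ↔ 0 ≤ a * c - b ^ 2 := by
      constructor
      · intro h1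
        by_contra h2
        exact absurd h1 (not_le.2 (div_neg_of_neg_of_pos (not_le.1 h2) (by positivity)))
      · intro h1; positivity
    rw [e3, sub_nonneg]
    refine ⟨fun h1 => ⟨?_, hpos.le, h1⟩, fun h1 => h1.2.2⟩
    by_contra h2
    nlinarith [sq_nonneg b]

theorem listed_of_nilpotent (hK : IsRegularConvexCone K) (hA : A ∈ coneAutLie K hc)
    (h : Indep3 u v w) (hu : A u = 0) (hv : A v = u) (hw : A w = v) :
    ∃ T : ConeType, ConeIsomorphic K T.cone := by
  -- At time `1/s` and scaled by `s²`, the flow tends to `(z/2) u` as `s → 0`.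
  have hlim : ∀ {x y z : ℝ}, x • u + y • v + z • w ∈ K → z • u ∈ K := by
    intro x y z hx
    have := hK.limit_zero_mem
      (F := fun s => (s ^ 2 * x + s * y + z / 2) • u + (s ^ 2 * y + s * z) • v + (s ^ 2 * z) • w)
      (by fun_prop) fun s hs => by
        have h1 := hK.smul_mem (s ^ 2) (by positivity) _ (nilpotent_flow hA hu hv hw s⁻¹ hx)
        convert h1 using 1
        match_scalars <;> field_simp
    have h2 := hK.smul_mem 2 two_pos _ this
    convert h2 using 1
    match_scalars <;> ring
  obtain ⟨z, y, x, hzne, hx⟩ := hK.exists_coord_ne_zero h.swap02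
  have hx : x • u + y • v + z • w ∈ K := by convert hx using 1; module
  rcases hzne.lt_or_gt with hneg | hpos
  · have huK : -u ∈ K := (hK.smul_mem_iff (neg_pos.2 hneg)).1 (by simpa using hlim hx)
    -- All three vectors change sign together, which keeps the chain `w ↦ v ↦ u ↦ 0`.
    refine listed_of_nilpotent_aux hK hA h.neg0.neg1.neg2 (by simp [hu]) (by simp [hv])
      (by simp [hw]) huK fun {x y z} hx => ?_
    refine hK.nonneg_of_smul_mem huK (neg_ne_zero.2 h.ne_zero) ?_
    have := hlim (x := -x) (y := -y) (z := -z) (by convert hx using 1; module)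
    simpa using this
  · have huK : u ∈ K := (hK.smul_mem_iff hpos).1 (hlim hx)
    exact listed_of_nilpotent_aux hK hA h hu hv hw huK fun hx =>
      hK.nonneg_of_smul_mem huK h.ne_zero (hlim hx)

end Nilpotent

/-! ### Complex eigenvalues: the circular cone -/

section Rotation

variable {u v w : E3} {δ : ℝ}

theorem rotation_flow (hA : A ∈ coneAutLie K hc) (hu : A u = δ • u) (hv : A v = w)
    (hw : A w = -v) (t : ℝ) {x y z : ℝ} (hx : x • u + y • v + z • w ∈ K) :
    (Real.exp (δ * t) * x) • u + (y * Real.cos t - z * Real.sin t) • v +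
      (y * Real.sin t + z * Real.cos t) • w ∈ K := by
  refine flow_comb_mem hA (f := fun t => Real.exp (δ * t) * x)
    (g := fun t => y * Real.cos t - z * Real.sin t) (h := fun t => y * Real.sin t + z * Real.cos t)
    (f' := fun t => Real.exp (δ * t) * δ * x) (g' := fun t => y * -Real.sin t - z * Real.cos t)
    (h' := fun t => y * Real.cos t + z * -Real.sin t)
    (fun t => ?_) (fun t => ?_) (fun t => ?_) (fun t => ?_) (by simpa using hx) t
  · exact (HasDerivAt.exp (by simpa using (hasDerivAt_id t).const_mul δ)).mul_const x
  · exact ((Real.hasDerivAt_cos t).const_mul y).sub ((Real.hasDerivAt_sin t).const_mul z)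
  · exact ((Real.hasDerivAt_sin t).const_mul y).add ((Real.hasDerivAt_cos t).const_mul z)
  · simp only [map_add, map_smul, hu, hv, hw]
    module

/-- If `δ ≠ 0`, many full turns in the direction that contracts `u` return the `v, w` part to itself
while the `u` part dies out. The limit and its half-turn are opposite nonzero vectors of the cone.
-/
theorem rotation_rate_eq_zero (hK : IsRegularConvexCone K) (hA : A ∈ coneAutLie K hc)
    (h : Indep3 u v w) (hu : A u = δ • u) (hv : A v = w) (hw : A w = -v) : δ = 0 := by
  by_contra hδ
  obtain ⟨y, x, z, hy, hx⟩ := hK.exists_coord_ne_zero h.swap01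
  have hx : x • u + y • v + z • w ∈ K := by convert hx using 1; module
  obtain ⟨σ, hσ, hσδ⟩ : ∃ σ : ℤ, (σ = 1 ∨ σ = -1) ∧ δ * σ < 0 := by
    rcases (show δ ≠ 0 from hδ).lt_or_gt with h | h
    · exact ⟨1, Or.inl rfl, by simpa using h⟩
    · exact ⟨-1, Or.inr rfl, by simpa using h⟩
  have hlim : ∀ a : ℝ, (0 : ℝ) • u + (y * Real.cos a - z * Real.sin a) • v +
      (y * Real.sin a + z * Real.cos a) • w ∈ K := by
    intro a
    have hmem : ∀ n : ℕ, (Real.exp (δ * (a + ((σ * n : ℤ) : ℝ) * (2 * Real.pi))) * x) • u +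
        (y * Real.cos a - z * Real.sin a) • v + (y * Real.sin a + z * Real.cos a) • w ∈ K := by
      intro n
      have := rotation_flow hA hu hv hw (a + ((σ * n : ℤ) : ℝ) * (2 * Real.pi)) hx
      rwa [Real.cos_add_int_mul_two_pi, Real.sin_add_int_mul_two_pi] at this
    have ht : Tendsto (fun n : ℕ => Real.exp (δ * (a + ((σ * n : ℤ) : ℝ) * (2 * Real.pi))) * x)
        atTop (𝓝 0) := by
      have h1 : Tendsto (fun n : ℕ => δ * a + (δ * σ * (2 * Real.pi)) * (n : ℝ)) atTop atBot :=
        tendsto_atBot_add_const_left _ _ ((tendsto_natCast_atTop_atTop).const_mul_atTop_of_neg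
          (mul_neg_of_neg_of_pos hσδ Real.two_pi_pos))
      have h2 := (Real.tendsto_exp_atBot.comp h1).mul_const x
      rw [zero_mul] at h2
      refine h2.congr fun n => ?_
      simp only [Function.comp]
      congr 2
      push_cast
      ring
    exact hK.isClosed.mem_of_tendsto
      (((ht.smul_const u).add tendsto_const_nhds).add tendsto_const_nhds)
      (Eventually.of_forall hmem)
  have h0 := hlim 0
  have hpi := hlim Real.pi
  simp only [Real.cos_zero, Real.sin_zero, Real.cos_pi, Real.sin_pi] at h0 hpi
  have hz := hK.eq_zero_of_neg_mem h0 (by convert hpi using 1; module)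
  have := (h _ _ _ hz).2.1
  apply hy
  linarith

theorem listed_of_rotation_aux (hK : IsRegularConvexCone K) (hA : A ∈ coneAutLie K hc)
    (h : Indep3 u v w) (hu : A u = 0) (hv : A v = w) (hw : A w = -v) (huK : u ∈ K)
    (hpos : ∀ {x y z : ℝ}, x • u + y • v + z • w ∈ K → 0 ≤ x)
    (hpos0 : ∀ {y z : ℝ}, (0 : ℝ) • u + y • v + z • w ∈ K → y = 0 ∧ z = 0) :
    ∃ T : ConeType, ConeIsomorphic K T.cone := by
  have fl : ∀ (t : ℝ) {x y z : ℝ}, x • u + y • v + z • w ∈ K → x • u +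
      (y * Real.cos t - z * Real.sin t) • v + (y * Real.sin t + z * Real.cos t) • w ∈ K := by
    intro t x y z hx
    simpa using rotation_flow (δ := 0) hA (by simpa using hu) hv hw t hx
  -- Rotating by minus the argument of `y + iz` moves the point into the half-plane spanned by `u`
  -- and the ray of `v`.
  have hred : ∀ x y z : ℝ, x • u + y • v + z • w ∈ K ↔
      x • u + (√(y ^ 2 + z ^ 2)) • v + (0 : ℝ) • w ∈ K := by
    intro x y z
    have h1 := Complex.norm_mul_cos_arg ⟨y, z⟩
    have h2 := Complex.norm_mul_sin_arg ⟨y, z⟩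
    rw [Complex.norm_def, Complex.normSq_mk, ← pow_two, ← pow_two] at h1 h2
    simp only at h1 h2
    set φ := Complex.arg ⟨y, z⟩
    set ρ := √(y ^ 2 + z ^ 2)
    constructor
    · intro hx
      have := fl (-φ) hx
      rw [Real.cos_neg, Real.sin_neg] at this
      have e1 : y * Real.cos φ - z * -Real.sin φ = ρ := by
        rw [← h1, ← h2]; linear_combination ρ * Real.sin_sq_add_cos_sq φ
      have e2 : y * -Real.sin φ + z * Real.cos φ = 0 := by
        rw [← h1, ← h2]; ring
      rwa [e1, e2] at this
    · intro hx
      have := fl φ hx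
      rwa [zero_mul, sub_zero, zero_mul, add_zero, h1, h2] at this
  have hvK : v ∉ K := by
    intro hvK
    have := (hpos0 (y := 1) (z := 0) (by convert hvK using 1; module)).1
    norm_num at this
  obtain ⟨R, hR, hmax⟩ := hK.exists_max hvK (w := u) ⟨0, by simpa using huK⟩
  have hle : ∀ {x ρ : ℝ}, 0 < x → x • u + ρ • v + (0 : ℝ) • w ∈ K → ρ ≤ R * x := by
    intro x ρ hx hm
    have h1 := hK.smul_mem x⁻¹ (inv_pos.2 hx) _ hm
    have h2 := hmax (ρ / x) (by
      convert h1 using 1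
      match_scalars <;> field_simp
      ring)
    rwa [div_le_iff₀ hx] at h2
  have hRpos : 0 < R := by
    obtain ⟨y, x, z, hy, hx⟩ := hK.exists_coord_ne_zero h.swap01
    have hx : x • u + y • v + z • w ∈ K := by convert hx using 1; module
    have hx0 : 0 < x := by
      refine lt_of_le_of_ne (hpos hx) ?_
      rintro rfl
      exact hy (hpos0 hx).1
    have h1 := hle hx0 ((hred _ _ _).1 hx)
    have h2 : 0 < √(y ^ 2 + z ^ 2) := Real.sqrt_pos.2 (by positivity)
    by_contra hcon
    nlinarith
  have hiff : ∀ x y z : ℝ, x • u + y • v + z • w ∈ K ↔ 0 ≤ x ∧ y ^ 2 + z ^ 2 ≤ R ^ 2 * x ^ 2 := by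
    intro x y z
    constructor
    · intro hx
      rcases (hpos hx).eq_or_lt with rfl | hx0
      · obtain ⟨rfl, rfl⟩ := hpos0 hx
        simp
      · refine ⟨hx0.le, ?_⟩
        have h1 := hle hx0 ((hred _ _ _).1 hx)
        rw [Real.sqrt_le_left (by positivity)] at h1
        linarith [mul_pow R x 2]
    · rintro ⟨hx0, h1⟩
      rw [hred]
      have h2 : √(y ^ 2 + z ^ 2) ≤ R * x := by
        rw [Real.sqrt_le_left (by positivity), mul_pow]; exact h1
      have h3 := hK.add_mem
        (hK.smul_mem' (c := √(y ^ 2 + z ^ 2) / R) (by positivity) hR)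
        (hK.smul_mem' (c := x - √(y ^ 2 + z ^ 2) / R)
          (by rw [sub_nonneg, div_le_iff₀ hRpos]; linarith) huK)
      convert h3 using 1
      match_scalars <;> field_simp <;> ring
  -- Null coordinates of the circular cone: with `x = (a+c)/2`, `y = Rb`, `z = R(a-c)/2` one has
  -- `R²x² - y² - z² = R²(ac - b²)`.
  have hI : Indep3 ((1 / 2 : ℝ) • u + (R / 2) • w) (R • v) ((1 / 2 : ℝ) • u + (-R / 2) • w) := by
    intro a b c e
    obtain ⟨h1, h2, h3⟩ := h ((a + c) / 2) (b * R) (R * ((a - c) / 2)) (by rw [← e]; module)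
    have h4 := (mul_eq_zero.1 h2).resolve_right hRpos.ne'
    have h5 := (mul_eq_zero.1 h3).resolve_left hRpos.ne'
    exact ⟨by linarith, h4, by linarith⟩
  refine listed_of_quadratic hI fun a b c => ?_
  have e : a • ((1 / 2 : ℝ) • u + (R / 2) • w) + b • R • v + c • ((1 / 2 : ℝ) • u + (-R / 2) • w) =
      ((a + c) / 2) • u + (b * R) • v + (R * ((a - c) / 2)) • w := by module
  rw [e, hiff]
  have e2 : (b * R) ^ 2 + (R * ((a - c) / 2)) ^ 2 ≤ R ^ 2 * ((a + c) / 2) ^ 2 ↔ b ^ 2 ≤ a * c := by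
    rw [← sub_nonneg, ← sub_nonneg (a := a * c)]
    have : R ^ 2 * ((a + c) / 2) ^ 2 - ((b * R) ^ 2 + (R * ((a - c) / 2)) ^ 2) =
      R ^ 2 * (a * c - b ^ 2) := by ring
    rw [this]
    exact mul_nonneg_iff_of_pos_left (by positivity)
  rw [e2]
  constructor
  · rintro ⟨h1, h2⟩
    refine ⟨?_, ?_, h2⟩ <;> by_contra h3 <;> nlinarith [sq_nonneg b]
  · rintro ⟨h1, h2, h3⟩
    exact ⟨by linarith, h3⟩

/-- Averaging a point with its half-turn projects it to the axis, so the axis ray of `u` or of `-u`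
lies in the cone. A point with no axis component is opposite to its half-turn, hence zero. -/
theorem listed_of_rotation (hK : IsRegularConvexCone K) (hA : A ∈ coneAutLie K hc)
    (h : Indep3 u v w) (hu : A u = δ • u) (hv : A v = w) (hw : A w = -v) :
    ∃ T : ConeType, ConeIsomorphic K T.cone := by
  obtain rfl := rotation_rate_eq_zero hK hA h hu hv hw
  have hneg : ∀ {x y z : ℝ}, x • u + y • v + z • w ∈ K → x • u + (-y) • v + (-z) • w ∈ K := by
    intro x y z hx
    simpa using rotation_flow hA hu hv hw Real.pi hx
  have hax : ∀ {x y z : ℝ}, x • u + y • v + z • w ∈ K → x • u ∈ K := by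
    intro x y z hx
    have := hK.smul_mem (1 / 2) (by norm_num) _ (hK.add_mem hx (hneg hx))
    convert this using 1
    module
  have hpos0 : ∀ {y z : ℝ}, (0 : ℝ) • u + y • v + z • w ∈ K → y = 0 ∧ z = 0 := by
    intro y z hx
    exact (h _ _ _ (hK.eq_zero_of_neg_mem hx (by convert hneg hx using 1; module))).2
  obtain ⟨x, y, z, hxne, hx⟩ := hK.exists_coord_ne_zero h
  rcases hxne.lt_or_gt with hlt | hgt
  · have huK : -u ∈ K := (hK.smul_mem_iff (neg_pos.2 hlt)).1 (by simpa using hax hx)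
    refine listed_of_rotation_aux hK hA h.neg0 (by simp [hu]) hv hw huK (fun {x y z} hx => ?_)
      (fun {y z} hx => hpos0 (by simpa using hx))
    refine hK.nonneg_of_smul_mem huK (neg_ne_zero.2 h.ne_zero) ?_
    have := hax (x := -x) (y := y) (z := z) (by convert hx using 1; module)
    simpa using this
  · have huK : u ∈ K := (hK.smul_mem_iff hgt).1 (hax hx)
    exact listed_of_rotation_aux hK hA h (by simp [hu]) hv hw huK
      (fun hx => hK.nonneg_of_smul_mem huK h.ne_zero (hax hx)) hpos0

end Rotation

/-! ### Jordan block of size two: the exponential cone -/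

section Jordan

variable {u v w : E3}

theorem jordan_flow (hA : A ∈ coneAutLie K hc) (hu : A u = 0) (hv : A v = v)
    (hw : A w = u) (t : ℝ) {x y z : ℝ} (hx : x • u + y • v + z • w ∈ K) :
    (x + t * z) • u + (Real.exp t * y) • v + z • w ∈ K := by
  refine flow_comb_mem hA (f := fun t => x + t * z)
    (g := fun t => Real.exp t * y) (h := fun _ => z)
    (f' := fun _ => z) (g' := fun t => Real.exp t * y) (h' := fun _ => 0)
    (fun t => ?_) (fun t => (Real.hasDerivAt_exp t).mul_const y) (fun t => hasDerivAt_const _ _)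
    (fun t => ?_) (by simpa using hx) t
  · simpa using ((hasDerivAt_id t).mul_const z).const_add x
  · simp [hu, hv, hw, add_comm]

theorem listed_of_jordan_aux (hK : IsRegularConvexCone K) (hA : A ∈ coneAutLie K hc)
    (h : Indep3 u v w) (hu : A u = 0) (hv : A v = v) (hw : A w = u) (huK : -u ∈ K) (hvK : v ∈ K)
    (hy : ∀ {x y z : ℝ}, x • u + y • v + z • w ∈ K → 0 ≤ y)
    (hz : ∀ {x y z : ℝ}, x • u + y • v + z • w ∈ K → 0 ≤ z) :
    ∃ T : ConeType, ConeIsomorphic K T.cone := by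
  have fl := fun (t : ℝ) {x y z : ℝ} => jordan_flow (x := x) (y := y) (z := z) hA hu hv hw t
  have hu0 : u ≠ 0 := h.ne_zero
  have hx0 : ∀ {x y : ℝ}, x • u + y • v + (0 : ℝ) • w ∈ K → x ≤ 0 := by
    intro x y hx
    have hmem : x • u + (0 * y) • v + (0 : ℝ) • w ∈ K := by
      refine hK.isClosed.mem_of_tendsto (tendsto_comb tendsto_const_nhds
        (Real.tendsto_exp_atBot.mul_const y) tendsto_const_nhds) (Eventually.of_forall fun t => ?_)
      simpa using fl t hx
    have := hK.nonneg_of_smul_mem huK (neg_ne_zero.2 hu0) (a := -x)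
      (by convert hmem using 1; module)
    linarith
  -- With `y = 0` and `z > 0` the orbit is a whole line in direction `u`.
  have hy0 : ∀ {x y z : ℝ}, 0 < z → x • u + y • v + z • w ∈ K → 0 < y := by
    intro x y z hzpos hx
    refine lt_of_le_of_ne (hy hx) ?_
    rintro rfl
    refine hK.no_line ⟨x • u + z • w, z • u, smul_ne_zero hzpos.ne' hu0, fun t => ?_⟩
    convert fl t hx using 1
    module
  -- Flow time `-log(y/z)` makes the last two coordinates equal; the orbit invariant is `x/z -
  -- log(y/z)`.
  have hred : ∀ {x y z : ℝ}, 0 < z → 0 < y → (x • u + y • v + z • w ∈ K ↔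
      (x / z - Real.log (y / z)) • u + (v + w) ∈ K) := by
    intro x y z hzpos hypos
    have hyz : 0 < y / z := by positivity
    constructor
    · intro hx
      have h1 := hK.smul_mem z⁻¹ (inv_pos.2 hzpos) _ (fl (-Real.log (y / z)) hx)
      rw [Real.exp_neg, Real.exp_log hyz] at h1
      convert h1 using 1
      match_scalars <;> field_simp
      ring
    · intro hx
      have hx' : (x / z - Real.log (y / z)) • u + (1 : ℝ) • v + (1 : ℝ) • w ∈ K := by
        convert hx using 1; module
      have h1 := hK.smul_mem z hzpos _ (fl (Real.log (y / z)) hx')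
      rw [Real.exp_log hyz] at h1
      convert h1 using 1
      match_scalars <;> field_simp <;> ring
  have hunK : u ∉ K := fun hn => hu0 (hK.eq_zero_of_neg_mem hn huK)
  obtain ⟨z, y, x, hzne, hx⟩ := hK.exists_coord_ne_zero h.swap02
  have hx : x • u + y • v + z • w ∈ K := by convert hx using 1; module
  have hzpos : 0 < z := lt_of_le_of_ne (hz hx) hzne.symm
  obtain ⟨c₀, hc₀, hmax⟩ := hK.exists_max hunK ⟨_, (hred hzpos (hy0 hzpos hx)).1 hx⟩
  have hiff : ∀ c : ℝ, c • u + (v + w) ∈ K ↔ c ≤ c₀ := fun c => ⟨hmax c, fun hle => by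
    have := hK.add_mem hc₀ (hK.smul_mem' (sub_nonneg.2 hle) huK)
    convert this using 1
    module⟩
  -- Shifting `w` by `c₀ u` turns `x/z - log(y/z) ≤ c₀` into `exp(a/c) ≤ b/c`.
  have hI : Indep3 u v (w + c₀ • u) := by
    intro a b c e
    have := h (a + c * c₀) b c (by rw [← e]; module)
    refine ⟨?_, this.2.1, this.2.2⟩
    have h1 := this.1
    rw [this.2.2] at h1
    linarith
  refine ⟨.expEpigraph, hI.coneIsomorphic fun a b c => ?_⟩
  have e : a • u + b • v + c • (w + c₀ • u) = (a + c * c₀) • u + b • v + c • w := by module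
  rw [e]
  change _ ↔ (a ≤ 0 ∧ 0 ≤ b ∧ c = 0) ∨ (Real.exp (a / c) ≤ b / c ∧ 0 < c)
  rcases lt_trichotomy c 0 with hneg | rfl | hpos
  · refine iff_of_false (fun hm => ?_) ?_
    · linarith [hz hm]
    · rintro (⟨-, -, rfl⟩ | ⟨-, h1⟩) <;> linarith
  · constructor
    · intro hm
      refine Or.inl ⟨?_, hy hm, rfl⟩
      simpa using hx0 hm
    · rintro (⟨h1, h2, -⟩ | ⟨-, h1⟩)
      · have := hK.add_mem (hK.smul_mem' (neg_nonneg.2 h1) huK) (hK.smul_mem' h2 hvK)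
        convert this using 1
        module
      · exact absurd h1 (lt_irrefl _)
  · have hor : (a ≤ 0 ∧ 0 ≤ b ∧ c = 0) ∨ (Real.exp (a / c) ≤ b / c ∧ 0 < c) ↔
        Real.exp (a / c) ≤ b / c := by
      simp [hpos, hpos.ne']
    rw [hor]
    rcases le_or_gt b 0 with hb | hb
    · refine iff_of_false (fun hm => ?_) (fun hm => ?_)
      · linarith [hy0 hpos hm]
      · exact absurd (hm.trans (div_nonpos_of_nonpos_of_nonneg hb hpos.le))
          (not_le.2 (Real.exp_pos _))
    · rw [hred hpos hb, hiff, ← Real.le_log_iff_exp_le (by positivity)]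
      have e2 : (a + c * c₀) / c = a / c + c₀ := by field_simp
      rw [e2]
      constructor <;> intro h1 <;> linarith

/-- Scaled by `exp(-t)` as `t → ∞`, the flow tends to `y v`; at time `-t` and scaled by `1/t`, it
tends to `-z u`. These limits fix the signs of the basis vectors. -/
theorem listed_of_jordan (hK : IsRegularConvexCone K) (hA : A ∈ coneAutLie K hc)
    (h : Indep3 u v w) (hu : A u = 0) (hv : A v = v) (hw : A w = u) :
    ∃ T : ConeType, ConeIsomorphic K T.cone := by
  have fl := fun (t : ℝ) {x y z : ℝ} => jordan_flow (x := x) (y := y) (z := z) hA hu hv hw t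
  have hyv : ∀ {x y z : ℝ}, x • u + y • v + z • w ∈ K → y • v ∈ K := by
    intro x y z hx
    have h1 : Tendsto (fun t : ℝ => Real.exp (-t) * x + (t ^ 1 * Real.exp (-t)) * z) atTop
        (𝓝 (0 * x + 0 * z)) :=
      (Real.tendsto_exp_neg_atTop_nhds_zero.mul_const x).add
        ((Real.tendsto_pow_mul_exp_neg_atTop_nhds_zero 1).mul_const z)
    have hmem := hK.isClosed.mem_of_tendsto (tendsto_comb (u := u) (v := v) (w := w) h1
      (tendsto_const_nhds (x := y)) (Real.tendsto_exp_neg_atTop_nhds_zero.mul_const z))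
      (Eventually.of_forall fun t => by
        have h2 := hK.smul_mem _ (Real.exp_pos (-t)) _ (fl t hx)
        convert h2 using 1
        match_scalars
        · ring
        · rw [mul_one, mul_one, ← mul_assoc, ← Real.exp_add]; simp
        · ring)
    simpa using hmem
  have hzu : ∀ {x y z : ℝ}, x • u + y • v + z • w ∈ K → (-z) • u ∈ K := by
    intro x y z hx
    have h1 : Tendsto (fun t : ℝ => t⁻¹ * x - z) atTop (𝓝 (0 * x - z)) :=
      (tendsto_inv_atTop_zero.mul_const x).sub_const z
    have h2 : Tendsto (fun t : ℝ => t⁻¹ * Real.exp (-t) * y) atTop (𝓝 (0 * 0 * y)) :=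
      (tendsto_inv_atTop_zero.mul Real.tendsto_exp_neg_atTop_nhds_zero).mul_const y
    have hmem := hK.isClosed.mem_of_tendsto (tendsto_comb (u := u) (v := v) (w := w) h1 h2
      (tendsto_inv_atTop_zero.mul_const z))
      ((eventually_gt_atTop 0).mono fun t ht => by
        have h2 := hK.smul_mem _ (inv_pos.2 ht) _ (fl (-t) hx)
        convert h2 using 1
        match_scalars <;> field_simp
        ring)
    simpa using hmem
  obtain ⟨z, y, x, hzne, hx⟩ := hK.exists_coord_ne_zero h.swap02
  have hx : x • u + y • v + z • w ∈ K := by convert hx using 1; module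
  obtain ⟨y', x', z', hyne, hx'⟩ := hK.exists_coord_ne_zero h.swap01
  have hx' : x' • u + y' • v + z' • w ∈ K := by convert hx' using 1; module
  -- The signs `r, s = ±1`: `r` multiplies both `u` and `w`, to preserve `A w = u`, and `s`
  -- multiplies `v`.
  obtain ⟨r, hr, hrz⟩ : ∃ r : ℝ, r * r = 1 ∧ 0 < r * z := by
    rcases hzne.lt_or_gt with h | h
    · exact ⟨-1, by norm_num, by linarith⟩
    · exact ⟨1, by norm_num, by linarith⟩
  obtain ⟨s, hs, hsy⟩ : ∃ s : ℝ, s * s = 1 ∧ 0 < s * y' := by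
    rcases hyne.lt_or_gt with h | h
    · exact ⟨-1, by norm_num, by linarith⟩
    · exact ⟨1, by norm_num, by linarith⟩
  have hr0 : r ≠ 0 := by rintro rfl; simp at hr
  have hs0 : s ≠ 0 := by rintro rfl; simp at hs
  have huK : -(r • u) ∈ K := by
    refine (hK.smul_mem_iff hrz).1 ?_
    convert hzu hx using 1
    match_scalars
    linear_combination -z * hr
  have hvK : s • v ∈ K := by
    refine (hK.smul_mem_iff hsy).1 ?_
    convert hyv hx' using 1
    match_scalars
    linear_combination y' * hs
  have h' := h.smul hr0 hs0 hr0
  refine listed_of_jordan_aux hK hA h' (by simp [hu]) (by simp [hv]) (by simp [hw]) huK hvK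
    (fun {x y z} hx => ?_) (fun {x y z} hx => ?_)
  · refine hK.nonneg_of_smul_mem hvK h'.swap01.ne_zero ?_
    have := hyv (x := x * r) (y := y * s) (z := z * r) (by simpa only [mul_smul] using hx)
    rwa [mul_smul] at this
  · refine hK.nonneg_of_smul_mem huK (neg_ne_zero.2 h'.ne_zero) ?_
    have := hzu (x := x * r) (y := y * s) (z := z * r) (by simpa only [mul_smul] using hx)
    convert this using 1
    module

end Jordan

end IsRegularConvexCone

namespace IsRegularConvexCone

variable {K : Set E3} {hc : IsClosed K} {A : E3 →L[ℝ] E3} {u v w : E3}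

/-! ### Rank-one projection: the orthant -/

section Projection

theorem projection_flow (hA : A ∈ coneAutLie K hc) (hu : A u = u) (hv : A v = 0) (hw : A w = 0)
    (t : ℝ) {x y z : ℝ} (hx : x • u + y • v + z • w ∈ K) :
    (Real.exp t * x) • u + y • v + z • w ∈ K := by
  refine flow_comb_mem hA (f := fun t => Real.exp t * x)
    (g := fun _ => y) (h := fun _ => z) (f' := fun t => Real.exp t * x) (g' := fun _ => 0)
    (h' := fun _ => 0) (fun t => (Real.hasDerivAt_exp t).mul_const x)
    (fun t => hasDerivAt_const _ _) (fun t => hasDerivAt_const _ _) (fun t => ?_)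
    (by simpa using hx) t
  simp [hu, hv, hw]

/-- Both components are limits of the flow: as `t → ∞` after scaling by `exp(-t)`, and as `t → -∞`.
The cone is therefore a ray plus a planar cone. -/
theorem projection_mem (hK : IsRegularConvexCone K) (hA : A ∈ coneAutLie K hc) (hu : A u = u)
    (hv : A v = 0) (hw : A w = 0) {x y z : ℝ} (hx : x • u + y • v + z • w ∈ K) :
    x • u ∈ K ∧ y • v + z • w ∈ K := by
  constructor
  · have h1 := Real.tendsto_exp_neg_atTop_nhds_zero
    have hmem := hK.isClosed.mem_of_tendsto (tendsto_comb (u := u) (v := v) (w := w)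
      (tendsto_const_nhds (x := x)) (h1.mul_const y) (h1.mul_const z))
      (Eventually.of_forall fun t => by
        have h2 := hK.smul_mem _ (Real.exp_pos (-t)) _ (projection_flow hA hu hv hw t hx)
        convert h2 using 1
        match_scalars
        · rw [mul_one, mul_one, ← mul_assoc, ← Real.exp_add]; simp
        · ring
        · ring)
    simpa using hmem
  · have hmem := hK.isClosed.mem_of_tendsto (tendsto_comb (u := u) (v := v) (w := w)
      (Real.tendsto_exp_atBot.mul_const x) (tendsto_const_nhds (x := y))
      (tendsto_const_nhds (x := z)))
      (Eventually.of_forall fun t => projection_flow hA hu hv hw t hx)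
    simpa using hmem

/-- The planar factor is a pointed cone containing `v` and `w`; its extreme rays `v - s w` and `w -
r v` are the last points on two lines. Together with `u` they span an orthant. -/
theorem listed_of_projection_aux (hK : IsRegularConvexCone K) (hA : A ∈ coneAutLie K hc)
    (h : Indep3 u v w) (hu : A u = u) (hv : A v = 0) (hw : A w = 0) (huK : u ∈ K) (hvK : v ∈ K)
    (hwK : w ∈ K) : ∃ T : ConeType, ConeIsomorphic K T.cone := by
  have hu0 := h.ne_zero
  have hv0 := h.swap01.ne_zero
  have hw0 := h.swap02.ne_zero
  have hmem : ∀ x y z : ℝ, x • u + y • v + z • w ∈ K ↔ 0 ≤ x ∧ y • v + z • w ∈ K := by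
    intro x y z
    constructor
    · intro hx
      have := projection_mem hK hA hu hv hw hx
      exact ⟨hK.nonneg_of_smul_mem huK hu0 this.1, this.2⟩
    · rintro ⟨hx, h1⟩
      rw [add_assoc]
      exact hK.add_mem (hK.smul_mem' hx huK) h1
  obtain ⟨s, hs, hsmax⟩ := hK.exists_max (u := -w) (w := v)
    (fun hn => hw0 (hK.eq_zero_of_neg_mem hwK hn)) ⟨0, by simpa using hvK⟩
  obtain ⟨r, hr, hrmax⟩ := hK.exists_max (u := -v) (w := w)
    (fun hn => hv0 (hK.eq_zero_of_neg_mem hvK hn)) ⟨0, by simpa using hwK⟩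
  have hs0 : 0 ≤ s := hsmax 0 (by simpa using hvK)
  have hr0 : 0 ≤ r := hrmax 0 (by simpa using hwK)
  have hzge : ∀ {y z : ℝ}, 0 ≤ y → y • v + z • w ∈ K → 0 ≤ z + s * y := by
    intro y z hy hm
    rcases hy.eq_or_lt with rfl | hy
    · have := hK.nonneg_of_smul_mem hwK hw0 (a := z) (by simpa using hm)
      simpa using this
    · have h1 := hsmax (-z / y) (by
        have h2 := hK.smul_mem y⁻¹ (inv_pos.2 hy) _ hm
        convert h2 using 1
        match_scalars <;> field_simp)
      rw [div_le_iff₀ hy] at h1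
      linarith
  have hyge : ∀ {y z : ℝ}, 0 ≤ z → y • v + z • w ∈ K → 0 ≤ y + r * z := by
    intro y z hz hm
    rcases hz.eq_or_lt with rfl | hz
    · have := hK.nonneg_of_smul_mem hvK hv0 (a := y) (by simpa using hm)
      simpa using this
    · have h1 := hrmax (-y / z) (by
        have h2 := hK.smul_mem z⁻¹ (inv_pos.2 hz) _ hm
        convert h2 using 1
        match_scalars <;> field_simp)
      rw [div_le_iff₀ hz] at h1
      linarith
  have hor : ∀ {y z : ℝ}, y • v + z • w ∈ K → 0 ≤ y ∨ 0 ≤ z := by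
    intro y z hm
    by_contra! hcon
    have h1 := hK.add_mem hm (hK.smul_mem' (neg_nonneg.2 hcon.2.le) hwK)
    have := hK.nonneg_of_smul_mem hvK hv0 (a := y) (by convert h1 using 1; module)
    linarith
  -- This is the determinant of the new planar basis. It is nonnegative because `(v - s w) + s (w -
  -- r v) = (1 - rs) v` is in the cone; if it vanished, a vector and its negative would both be in
  -- the cone.
  have hrs : 0 < 1 - r * s := by
    have h1 := hK.add_mem hs (hK.smul_mem' hs0 hr)
    have h2 := hK.nonneg_of_smul_mem hvK hv0 (a := 1 - r * s) (by convert h1 using 1; module)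
    refine lt_of_le_of_ne h2 fun he => ?_
    have h3 := hK.eq_zero_of_neg_mem (hK.smul_mem' hs0 hr) (by
      convert hs using 1
      match_scalars
      · linear_combination he
      · ring)
    have h4 := h 0 (-(s * r)) s (by rw [← h3]; module)
    rw [h4.2.2] at he
    norm_num at he
  have hI : Indep3 u (s • (-w) + v) (r • (-v) + w) := by
    intro a b c e
    obtain ⟨h1, h2, h3⟩ := h a (b - r * c) (c - s * b) (by rw [← e]; module)
    have hc0 : c * (1 - r * s) = 0 := by linear_combination h3 + s * h2
    have hc := (mul_eq_zero.1 hc0).resolve_right hrs.ne'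
    subst hc
    exact ⟨h1, by linarith, rfl⟩
  refine ⟨.orthant, hI.coneIsomorphic fun a b c => ?_⟩
  change _ ↔ 0 ≤ a ∧ 0 ≤ b ∧ 0 ≤ c
  have e : a • u + b • (s • (-w) + v) + c • (r • (-v) + w) =
      a • u + (b - r * c) • v + (c - s * b) • w := by module
  constructor
  · intro hm
    rw [e, hmem] at hm
    obtain ⟨ha, hm⟩ := hm
    refine ⟨ha, ?_⟩
    rcases hor hm with h1 | h1
    · have h2 := hzge h1 hm
      have hc : 0 ≤ c := by
        by_contra hcon
        nlinarith [mul_pos (neg_pos.2 (not_le.1 hcon)) hrs]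
      exact ⟨by nlinarith [mul_nonneg hr0 hc], hc⟩
    · have h2 := hyge h1 hm
      have hb : 0 ≤ b := by
        by_contra hcon
        nlinarith [mul_pos (neg_pos.2 (not_le.1 hcon)) hrs]
      exact ⟨hb, by nlinarith [mul_nonneg hs0 hb]⟩
  · rintro ⟨ha, hb, hc⟩
    exact hK.add_mem (hK.add_mem (hK.smul_mem' ha huK) (hK.smul_mem' hb hs)) (hK.smul_mem' hc hr)

/-- Components of points of the cone replace `u`, then `v`, then `w`. Any basis of the kernel
serves, so the last two can be chosen inside the planar factor. -/
theorem listed_of_projection (hK : IsRegularConvexCone K) (hA : A ∈ coneAutLie K hc)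
    (h : Indep3 u v w) (hu : A u = u) (hv : A v = 0) (hw : A w = 0) :
    ∃ T : ConeType, ConeIsomorphic K T.cone := by
  obtain ⟨x, y, z, hx, hm⟩ := hK.exists_coord_ne_zero h
  have huK := (hK.projection_mem hA hu hv hw hm).1
  have h1 : Indep3 (x • u) v w := by simpa using h.smul hx one_ne_zero one_ne_zero
  obtain ⟨y, x', z, hy, hm⟩ := hK.exists_coord_ne_zero h1.swap01
  have hu1 : A (x • u) = x • u := by simp [hu]
  have hvK := (hK.projection_mem (x := x') (y := y) (z := z) hA hu1 hv hw
    (by convert hm using 1; module)).2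
  have hv2 : A (y • v + z • w) = 0 := by simp [hv, hw]
  have h2 : Indep3 (x • u) (y • v + z • w) w := by
    intro a b c e
    obtain ⟨h3, h4, h5⟩ := h1 a (b * y) (b * z + c) (by rw [← e]; module)
    have hb := (mul_eq_zero.1 h4).resolve_right hy
    subst hb
    exact ⟨h3, rfl, by linarith⟩
  obtain ⟨z', y', x'', hz, hm⟩ := hK.exists_coord_ne_zero h2.swap02
  have hwK := (hK.projection_mem (x := x'') (y := y') (z := z') hA hu1 hv2 hw
    (by convert hm using 1; module)).2
  have h3 : Indep3 (x • u) (y • v + z • w) (y' • (y • v + z • w) + z' • w) := by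
    intro a b c e
    obtain ⟨h3, h4, h5⟩ := h2 a (b + c * y') (c * z') (by rw [← e]; module)
    have hb := (mul_eq_zero.1 h5).resolve_right hz
    subst hb
    exact ⟨h3, by linarith, rfl⟩
  exact listed_of_projection_aux hK hA h3 hu1 hv2 (by rw [map_add, map_smul, map_smul, hv2, hw]; simp)
    huK hvK hwK

end Projection

/-! ### Three distinct eigenvalues: power cones -/

section Diagonal

variable {θ : ℝ}

theorem diagonal_flow (hA : A ∈ coneAutLie K hc) (hu : A u = u) (hv : A v = θ • v)
    (hw : A w = 0) (t : ℝ) {x y z : ℝ} (hx : x • u + y • v + z • w ∈ K) :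
    (Real.exp t * x) • u + (Real.exp (θ * t) * y) • v + z • w ∈ K := by
  refine flow_comb_mem hA (f := fun t => Real.exp t * x)
    (g := fun t => Real.exp (θ * t) * y) (h := fun _ => z) (f' := fun t => Real.exp t * x)
    (g' := fun t => Real.exp (θ * t) * θ * y) (h' := fun _ => 0)
    (fun t => (Real.hasDerivAt_exp t).mul_const x)
    (fun t => (HasDerivAt.exp (by simpa using (hasDerivAt_id t).const_mul θ)).mul_const y)
    (fun t => hasDerivAt_const _ _) (fun t => ?_) (by simpa using hx) t
  simp only [map_add, map_smul, hu, hv, hw]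
  module

/-- Each axis component survives alone under a suitable rescaling of the flow as `t → ±∞`. The
middle one dominates only once an outer coordinate is absent, since `0 < θ < 1`. -/
theorem diagonal_mem (hK : IsRegularConvexCone K) (hA : A ∈ coneAutLie K hc) (hu : A u = u)
    (hv : A v = θ • v) (hw : A w = 0) (hθ : 0 < θ) (hθ' : θ < 1) {x y z : ℝ}
    (hx : x • u + y • v + z • w ∈ K) :
    x • u ∈ K ∧ z • w ∈ K ∧ (x = 0 ∨ z = 0 → y • v ∈ K) := by
  have hexp : ∀ {r : ℝ}, r < 0 → Tendsto (fun t => Real.exp (r * t)) atTop (𝓝 0) := fun hr =>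
    Real.tendsto_exp_atBot.comp (tendsto_id.const_mul_atTop_of_neg hr)
  refine ⟨?_, ?_, ?_⟩
  · have hmem := hK.isClosed.mem_of_tendsto (tendsto_comb (u := u) (v := v) (w := w)
      (tendsto_const_nhds (x := x)) ((hexp (sub_neg.2 hθ')).mul_const y)
      ((hexp (neg_one_lt_zero)).mul_const z))
      (Eventually.of_forall fun t => by
        have h2 := hK.smul_mem _ (Real.exp_pos (-t)) _ (diagonal_flow hA hu hv hw t hx)
        convert h2 using 1
        match_scalars
        · rw [mul_one, mul_one, ← mul_assoc, ← Real.exp_add]; simp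
        · rw [mul_one, mul_one, ← mul_assoc, ← Real.exp_add]; ring_nf
        · ring_nf)
    simpa using hmem
  · have hmem := hK.isClosed.mem_of_tendsto (tendsto_comb (u := u) (v := v) (w := w)
      ((hexp (neg_one_lt_zero)).mul_const x) ((hexp (neg_lt_zero.2 hθ)).mul_const y)
      (tendsto_const_nhds (x := z)))
      (Eventually.of_forall fun t => by
        convert diagonal_flow hA hu hv hw (-t) hx using 1
        ring_nf)
    simpa using hmem
  · rintro (rfl | rfl)
    · have hmem := hK.isClosed.mem_of_tendsto (tendsto_comb (u := u) (v := v) (w := w)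
        (tendsto_const_nhds (x := (0 : ℝ))) (tendsto_const_nhds (x := y))
        ((hexp (neg_lt_zero.2 hθ)).mul_const z))
        (Eventually.of_forall fun t => by
          have h2 := hK.smul_mem _ (Real.exp_pos (-θ * t)) _ (diagonal_flow hA hu hv hw t hx)
          convert h2 using 1
          match_scalars
          · ring
          · rw [mul_one, mul_one, ← mul_assoc, ← Real.exp_add]; simp
          · ring)
      simpa using hmem
    · have hmem := hK.isClosed.mem_of_tendsto (tendsto_comb (u := u) (v := v) (w := w)
        ((hexp (sub_neg.2 hθ')).mul_const x) (tendsto_const_nhds (x := y))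
        (tendsto_const_nhds (x := (0 : ℝ))))
        (Eventually.of_forall fun t => by
          have h2 := hK.smul_mem _ (Real.exp_pos (θ * t)) _ (diagonal_flow hA hu hv hw (-t) hx)
          convert h2 using 1
          match_scalars
          · rw [mul_one, mul_one, ← mul_assoc, ← Real.exp_add]; ring_nf
          · rw [mul_one, mul_one, ← mul_assoc, ← Real.exp_add]; simp
          · ring)
      simpa using hmem

/-- Flow time `-log(x/z)` equalizes the outer coordinates, and `y / (x^θ z^(1-θ))` is invariant
under flow and scaling. -/
theorem diagonal_mem_iff (hK : IsRegularConvexCone K) (hA : A ∈ coneAutLie K hc) (hu : A u = u)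
    (hv : A v = θ • v) (hw : A w = 0) {x y z : ℝ} (hx : 0 < x) (hz : 0 < z) :
    x • u + y • v + z • w ∈ K ↔ (y / (x ^ θ * z ^ (1 - θ))) • v + (u + w) ∈ K := by
  have h1 : Real.exp (θ * Real.log (x / z)) = x ^ θ / z ^ θ := by
    rw [mul_comm, ← Real.rpow_def_of_pos (by positivity), Real.div_rpow hx.le hz.le]
  have h2 : z ^ (1 - θ) = z / z ^ θ := by rw [Real.rpow_sub hz, Real.rpow_one]
  have hxθ : 0 < x ^ θ := by positivity
  have hzθ : 0 < z ^ θ := by positivity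
  rw [h2]
  constructor
  · intro hm
    have h3 := hK.smul_mem z⁻¹ (inv_pos.2 hz) _
      (diagonal_flow hA hu hv hw (-Real.log (x / z)) hm)
    rw [mul_neg, Real.exp_neg, Real.exp_neg, h1, Real.exp_log (by positivity)] at h3
    convert h3 using 1
    match_scalars <;> field_simp
  · intro hm
    have h3 := hK.smul_mem z hz _ (diagonal_flow (x := 1)
      (y := y / (x ^ θ * (z / z ^ θ))) (z := 1) hA hu hv hw
      (Real.log (x / z)) (by convert hm using 1; module))
    rw [h1, Real.exp_log (by positivity)] at h3
    convert h3 using 1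
    match_scalars <;> field_simp

theorem rpow_mul_rpow_eq_zero (hθ : 0 < θ) (hθ' : θ < 1) {x z : ℝ} (h : x = 0 ∨ z = 0) :
    x ^ θ * z ^ (1 - θ) = 0 := by
  rcases h with rfl | rfl
  · rw [Real.zero_rpow hθ.ne', zero_mul]
  · rw [Real.zero_rpow (by linarith), mul_zero]

/-- The section along `u + w + ℝv` is a half-line `[-c₀, ∞)`. Its end `c₀ = 0` gives the orthant;
otherwise `-c₀ v` as middle vector gives the hypograph cone. -/
theorem listed_of_diagonal_unbounded (hK : IsRegularConvexCone K) (hA : A ∈ coneAutLie K hc)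
    (h : Indep3 u v w) (hu : A u = u) (hv : A v = θ • v) (hw : A w = 0) (hθ : 0 < θ)
    (hθ' : θ ≤ 1 / 2) (huK : u ∈ K) (hwK : w ∈ K) (hvK : v ∈ K) :
    ∃ T : ConeType, ConeIsomorphic K T.cone := by
  have hθ1 : θ < 1 := by linarith
  have hv0 := h.swap01.ne_zero
  have hm := fun {x y z : ℝ} => diagonal_mem (x := x) (y := y) (z := z) hK hA hu hv hw hθ hθ1
  obtain ⟨c₀, hc₀, hmax⟩ := hK.exists_max (u := -v) (w := u + w)
    (fun hn => hv0 (hK.eq_zero_of_neg_mem hvK hn)) ⟨0, by simpa using hK.add_mem huK hwK⟩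
  have hc0 : 0 ≤ c₀ := hmax 0 (by simpa using hK.add_mem huK hwK)
  have hiff : ∀ x y z : ℝ, x • u + y • v + z • w ∈ K ↔
      0 ≤ x ∧ 0 ≤ z ∧ -c₀ * (x ^ θ * z ^ (1 - θ)) ≤ y := by
    intro x y z
    by_cases hx : 0 ≤ x
    swap
    · exact iff_of_false (fun h1 => hx (hK.nonneg_of_smul_mem huK h.ne_zero (hm h1).1))
        fun h1 => hx h1.1
    by_cases hz : 0 ≤ z
    swap
    · exact iff_of_false (fun h1 => hz (hK.nonneg_of_smul_mem hwK h.swap02.ne_zero (hm h1).2.1))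
        fun h1 => hz h1.2.1
    simp only [hx, hz, true_and]
    by_cases hxz : x = 0 ∨ z = 0
    · rw [rpow_mul_rpow_eq_zero hθ hθ1 hxz, mul_zero]
      constructor
      · intro h1
        exact hK.nonneg_of_smul_mem hvK hv0 ((hm h1).2.2 hxz)
      · intro hy
        exact hK.add_mem (hK.add_mem (hK.smul_mem' hx huK) (hK.smul_mem' hy hvK))
          (hK.smul_mem' hz hwK)
    · push Not at hxz
      have hx := lt_of_le_of_ne hx hxz.1.symm
      have hz := lt_of_le_of_ne hz hxz.2.symm
      have hpos : 0 < x ^ θ * z ^ (1 - θ) := by positivity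
      rw [diagonal_mem_iff hK hA hu hv hw hx hz, ← le_div_iff₀ hpos]
      constructor
      · intro h1
        have := hmax (-(y / (x ^ θ * z ^ (1 - θ)))) (by simpa using h1)
        linarith
      · intro h1
        have h2 := hK.add_mem hc₀ (hK.smul_mem' (c := y / (x ^ θ * z ^ (1 - θ)) + c₀)
          (by linarith) hvK)
        convert h2 using 1
        module
  rcases hc0.eq_or_lt with rfl | hpos
  · refine ⟨.orthant, h.coneIsomorphic fun a b c => ?_⟩
    rw [hiff]
    change _ ↔ 0 ≤ a ∧ 0 ≤ b ∧ 0 ≤ c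
    simp only [neg_zero, zero_mul]
    tauto
  · have hI : Indep3 u ((-c₀) • v) w := by
      simpa using h.smul one_ne_zero (neg_ne_zero.2 hpos.ne') one_ne_zero
    refine ⟨.powerHypograph (1 / θ) (1 / (1 - θ)) ?_ ?_, hI.coneIsomorphic fun a b c => ?_⟩
    · rw [le_div_iff₀ hθ]; linarith
    · simp only [one_div_one_div]; ring
    · rw [smul_smul, hiff]
      change _ ↔ b ≤ a ^ (1 / (1 / θ)) * c ^ (1 / (1 / (1 - θ))) ∧ 0 ≤ a ∧ 0 ≤ c
      rw [one_div_one_div, one_div_one_div]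
      have : -c₀ * (a ^ θ * c ^ (1 - θ)) ≤ b * -c₀ ↔ b ≤ a ^ θ * c ^ (1 - θ) := by
        rw [mul_comm b, mul_le_mul_left_of_neg (neg_lt_zero.2 hpos)]
      rw [this]
      tauto

/-- The section is `[-c₁, c₀]`; rescaling `v` by `c₀` leaves only the ratio `α = c₁/c₀`, which is
zero for the half power cone. -/
theorem listed_of_diagonal_bounded (hK : IsRegularConvexCone K) (h : Indep3 u v w) (hθ : 0 < θ)
    (hθ' : θ ≤ 1 / 2) {c₀ c₁ : ℝ} (h1 : 0 ≤ c₁) (h01 : c₁ ≤ c₀)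
    (hiff : ∀ x y z : ℝ, x • u + y • v + z • w ∈ K ↔ 0 ≤ x ∧ 0 ≤ z ∧
      -c₁ * (x ^ θ * z ^ (1 - θ)) ≤ y ∧ y ≤ c₀ * (x ^ θ * z ^ (1 - θ))) :
    ∃ T : ConeType, ConeIsomorphic K T.cone := by
  have hpos : 0 < c₀ := by
    refine lt_of_le_of_ne (h1.trans h01) ?_
    rintro rfl
    obtain rfl : c₁ = 0 := le_antisymm h01 h1
    obtain ⟨y, x, z, hy, hx⟩ := hK.exists_coord_ne_zero h.swap01
    have := (hiff x y z).1 (by convert hx using 1; module)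
    simp only [neg_zero, zero_mul] at this
    exact hy (le_antisymm this.2.2.2 this.2.2.1)
  have hI : Indep3 u (c₀ • v) w := by
    simpa using h.smul one_ne_zero hpos.ne' one_ne_zero
  have hp : 2 ≤ 1 / θ := by rw [le_div_iff₀ hθ]; linarith
  have hpq : 1 / (1 / θ) + 1 / (1 / (1 - θ)) = 1 := by simp only [one_div_one_div]; ring
  rcases h1.eq_or_lt with rfl | h1
  · refine ⟨.halfPower (1 / θ) (1 / (1 - θ)) hp hpq, hI.coneIsomorphic fun a b c => ?_⟩
    rw [smul_smul, hiff]
    change _ ↔ 0 ≤ b ∧ b ≤ a ^ (1 / (1 / θ)) * c ^ (1 / (1 / (1 - θ))) ∧ 0 ≤ a ∧ 0 ≤ c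
    rw [one_div_one_div, one_div_one_div]
    rw [mul_comm b, mul_le_mul_iff_right₀ hpos, neg_zero, zero_mul, mul_nonneg_iff_of_pos_left hpos]
    tauto
  · refine ⟨.power (1 / θ) (1 / (1 - θ)) (c₁ / c₀) hp hpq (by positivity)
      (by rwa [div_le_one hpos]), hI.coneIsomorphic fun a b c => ?_⟩
    rw [smul_smul, hiff]
    change _ ↔ -(c₁ / c₀) * (a ^ (1 / (1 / θ)) * c ^ (1 / (1 / (1 - θ)))) ≤ b ∧
      b ≤ a ^ (1 / (1 / θ)) * c ^ (1 / (1 / (1 - θ))) ∧ 0 ≤ a ∧ 0 ≤ c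
    rw [one_div_one_div, one_div_one_div]
    have e : -(c₁ / c₀) * (a ^ θ * c ^ (1 - θ)) = (-c₁ * (a ^ θ * c ^ (1 - θ))) / c₀ := by
      field_simp
    rw [e, div_le_iff₀ hpos, mul_comm b, mul_le_mul_iff_right₀ hpos]
    tauto

theorem listed_of_diagonal_aux (hK : IsRegularConvexCone K) (hA : A ∈ coneAutLie K hc)
    (h : Indep3 u v w) (hu : A u = u) (hv : A v = θ • v) (hw : A w = 0) (hθ : 0 < θ)
    (hθ' : θ ≤ 1 / 2) (huK : u ∈ K) (hwK : w ∈ K) :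
    ∃ T : ConeType, ConeIsomorphic K T.cone := by
  have hθ1 : θ < 1 := by linarith
  have hv0 := h.swap01.ne_zero
  have hm := fun {x y z : ℝ} => diagonal_mem (x := x) (y := y) (z := z) hK hA hu hv hw hθ hθ1
  have huw := hK.add_mem huK hwK
  by_cases hvK : v ∈ K
  · exact listed_of_diagonal_unbounded hK hA h hu hv hw hθ hθ' huK hwK hvK
  by_cases hnK : -v ∈ K
  · exact listed_of_diagonal_unbounded hK hA h.neg1 hu (by simp [hv]) hw hθ hθ' huK hwK hnK
  obtain ⟨c₀, hc₀, hmax₀⟩ := hK.exists_max (w := u + w) hvK ⟨0, by simpa using huw⟩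
  obtain ⟨c₁, hc₁, hmax₁⟩ := hK.exists_max (w := u + w) hnK ⟨0, by simpa using huw⟩
  have h0 : 0 ≤ c₀ := hmax₀ 0 (by simpa using huw)
  have h1 : 0 ≤ c₁ := hmax₁ 0 (by simpa using huw)
  have hline : ∀ {y : ℝ}, y • v ∈ K → y = 0 := by
    intro y hy
    by_contra hne
    rcases lt_or_gt_of_ne hne with hlt | hgt
    · exact hnK ((hK.smul_mem_iff (neg_pos.2 hlt)).1 (by simpa using hy))
    · exact hvK ((hK.smul_mem_iff hgt).1 hy)
  have hI : ∀ s : ℝ, s • v + (u + w) ∈ K ↔ -c₁ ≤ s ∧ s ≤ c₀ := by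
    intro s
    constructor
    · intro hs
      have := hmax₁ (-s) (by simpa using hs)
      exact ⟨by linarith, hmax₀ s hs⟩
    · rintro ⟨hs1, hs0⟩
      rcases le_total 0 s with hs | hs
      · rcases hs.eq_or_lt with rfl | hs
        · simpa using huw
        · have h2 := hK.add_mem (hK.smul_mem' (c := s / c₀) (by positivity) hc₀)
            (hK.smul_mem' (c := 1 - s / c₀)
              (sub_nonneg.2 (div_le_one_of_le₀ hs0 h0)) huw)
          have : c₀ ≠ 0 := by linarith
          convert h2 using 1
          match_scalars <;> field_simp <;> ring
      · rcases hs.eq_or_lt with rfl | hs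
        · simpa using huw
        · have h2 := hK.add_mem (hK.smul_mem' (c := -s / c₁)
              (div_nonneg (by linarith) h1) hc₁)
            (hK.smul_mem' (c := 1 - -s / c₁)
              (sub_nonneg.2 (div_le_one_of_le₀ (by linarith) h1)) huw)
          have : c₁ ≠ 0 := by linarith
          convert h2 using 1
          match_scalars <;> field_simp <;> ring
  have hiff : ∀ x y z : ℝ, x • u + y • v + z • w ∈ K ↔ 0 ≤ x ∧ 0 ≤ z ∧
      -c₁ * (x ^ θ * z ^ (1 - θ)) ≤ y ∧ y ≤ c₀ * (x ^ θ * z ^ (1 - θ)) := by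
    intro x y z
    by_cases hx : 0 ≤ x
    swap
    · exact iff_of_false (fun h1 => hx (hK.nonneg_of_smul_mem huK h.ne_zero (hm h1).1))
        fun h1 => hx h1.1
    by_cases hz : 0 ≤ z
    swap
    · exact iff_of_false (fun h1 => hz (hK.nonneg_of_smul_mem hwK h.swap02.ne_zero (hm h1).2.1))
        fun h1 => hz h1.2.1
    simp only [hx, hz, true_and]
    by_cases hxz : x = 0 ∨ z = 0
    · rw [rpow_mul_rpow_eq_zero hθ hθ1 hxz, mul_zero, mul_zero]
      constructor
      · intro h1
        rw [hline ((hm h1).2.2 hxz)]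
        exact ⟨le_rfl, le_rfl⟩
      · rintro ⟨hy, hy'⟩
        rw [le_antisymm hy' hy, zero_smul, add_zero]
        exact hK.add_mem (hK.smul_mem' hx huK) (hK.smul_mem' hz hwK)
    · push Not at hxz
      have hx := lt_of_le_of_ne hx hxz.1.symm
      have hz := lt_of_le_of_ne hz hxz.2.symm
      have hpos : 0 < x ^ θ * z ^ (1 - θ) := by positivity
      rw [diagonal_mem_iff hK hA hu hv hw hx hz, ← le_div_iff₀ hpos, ← div_le_iff₀ hpos, hI]
  rcases le_total c₁ c₀ with hle | hle
  · exact listed_of_diagonal_bounded hK h hθ hθ' h1 hle hiff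
  -- Reversing `v` exchanges the two ends, so the longer one may be taken as upper end; this is why
  -- `α ≤ 1`.
  · refine listed_of_diagonal_bounded hK h.neg1 hθ hθ' h0 hle fun x y z => ?_
    rw [smul_neg, ← neg_smul, hiff]
    constructor
    · rintro ⟨hx, hz, h2, h3⟩
      exact ⟨hx, hz, by linarith, by linarith⟩
    · rintro ⟨hx, hz, h2, h3⟩
      exact ⟨hx, hz, by linarith, by linarith⟩

theorem listed_of_diagonal_normalized (hK : IsRegularConvexCone K) (hA : A ∈ coneAutLie K hc)
    (h : Indep3 u v w) (hu : A u = u) (hv : A v = θ • v) (hw : A w = 0) (hθ : 0 < θ)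
    (hθ' : θ ≤ 1 / 2) : ∃ T : ConeType, ConeIsomorphic K T.cone := by
  have hm := fun {x y z : ℝ} =>
    diagonal_mem (x := x) (y := y) (z := z) hK hA hu hv hw hθ (by linarith)
  obtain ⟨x, y, z, hx0, hx⟩ := hK.exists_coord_ne_zero h
  have huK := (hm hx).1
  obtain ⟨z', y', x', hz0, hz⟩ := hK.exists_coord_ne_zero h.swap02
  have hwK := (hm (x := x') (y := y') (z := z') (by convert hz using 1; module)).2.1
  have h' : Indep3 (x • u) v (z' • w) := by simpa using h.smul hx0 one_ne_zero hz0
  exact listed_of_diagonal_aux hK hA h' (by simp [hu]) hv (by simp [hw]) hθ hθ' huK hwK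

/-- An affine change of `A` moves the eigenvalues to `1, θ, 0`. When `θ` exceeds `1/2`, the sign of
`A` and the order of the basis are reversed, replacing `θ` by `1 - θ`; this is why `p ≥ 2` suffices.
-/
theorem listed_of_diagonal (hK : IsRegularConvexCone K) (hA : A ∈ coneAutLie K hc)
    (h : Indep3 u v w) {a b c : ℝ} (hu : A u = a • u) (hv : A v = b • v) (hw : A w = c • w)
    (hab : b < a) (hbc : c < b) : ∃ T : ConeType, ConeIsomorphic K T.cone := by
  have hac : 0 < a - c := by linarith
  have h1 := one_mem_coneAutLie (hc := hc) hK
  rcases le_total ((b - c) / (a - c)) (1 / 2) with hle | hle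
  · refine listed_of_diagonal_normalized hK (A := (a - c)⁻¹ • (A - c • 1))
      (θ := (b - c) / (a - c)) (Submodule.smul_mem _ _ (Submodule.sub_mem _ hA
      (Submodule.smul_mem _ _ h1))) h ?_ ?_ ?_ (div_pos (by linarith) hac) hle
    · simp only [smul_apply, sub_apply, hu,
        one_apply_eq_self]
      match_scalars; field_simp
    · simp only [smul_apply, sub_apply, hv,
        one_apply_eq_self]
      match_scalars; field_simp
    · simp only [smul_apply, sub_apply, hw,
        one_apply_eq_self]
      module
  · have e : (a - b) / (a - c) = 1 - (b - c) / (a - c) := by field_simp; ring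
    refine listed_of_diagonal_normalized hK (A := (a - c)⁻¹ • (a • 1 - A))
      (θ := (a - b) / (a - c)) (Submodule.smul_mem _ _ (Submodule.sub_mem _
      (Submodule.smul_mem _ _ h1) hA)) h.swap02 ?_ ?_ ?_ (div_pos (by linarith) hac)
      (by rw [e]; linarith)
    · simp only [smul_apply, sub_apply, hw,
        one_apply_eq_self]
      match_scalars; field_simp
    · simp only [smul_apply, sub_apply, hv,
        one_apply_eq_self]
      match_scalars; field_simp
    · simp only [smul_apply, sub_apply, hu,
        one_apply_eq_self]
      module

end Diagonal

end IsRegularConvexCone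

/-! ### Reduction of a real 3×3 matrix to the model cases -/

-- A cubic without a real root would be irreducible, but irreducible real polynomials have degree at
-- most two.
open Polynomial in
theorem exists_charpoly_eq (f : E3 →ₗ[ℝ] E3) :
    ∃ l b c : ℝ, f.charpoly = (X - C l) * (X ^ 2 + C b * X + C c) := by
  have hmon := f.charpoly_monic
  have hdeg : f.charpoly.natDegree = 3 := by rw [LinearMap.charpoly_natDegree]; simp
  obtain ⟨l, hl⟩ : ∃ l, f.charpoly.IsRoot l := by
    by_contra! hno
    have hroots : f.charpoly.roots = 0 := by
      rw [Multiset.eq_zero_iff_forall_notMem]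
      intro r hr
      exact hno r (isRoot_of_mem_roots hr)
    have hirr := (hmon.irreducible_iff_roots_eq_zero_of_degree_le_three (by omega) (by omega)).2
      hroots
    have : f.charpoly.natDegree ≤ 2 := natDegree_le_iff_degree_le.2 hirr.degree_le_two
    omega
  have hmul := mul_divByMonic_eq_iff_isRoot.2 hl
  set q := f.charpoly /ₘ (X - C l)
  have hq : q.Monic := (monic_X_sub_C l).of_mul_monic_left (hmul ▸ hmon)
  have hqd : q.natDegree = 2 := by
    have := (monic_X_sub_C l).natDegree_mul hq
    rw [hmul, hdeg, natDegree_X_sub_C] at this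
    omega
  refine ⟨l, q.coeff 1, q.coeff 0, ?_⟩
  rw [← hmul]
  congr 1
  have h2 := q.as_sum_range_C_mul_X_pow
  have h3 : q.coeff 2 = 1 := hqd ▸ hq.coeff_natDegree
  rw [hqd, Finset.sum_range_succ, Finset.sum_range_succ, Finset.sum_range_one, h3] at h2
  nth_rw 1 [h2]
  simp only [pow_zero, mul_one, pow_one, map_one, one_mul]
  ring

theorem exists_eigenvector {f : E3 →ₗ[ℝ] E3} {r : ℝ} (hr : f.charpoly.IsRoot r) :
    ∃ v, v ≠ 0 ∧ f v = r • v := by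
  obtain ⟨v, hv⟩ := (Module.End.hasEigenvalue_iff_isRoot_charpoly f r).2 hr |>.exists_hasEigenvector
  exact ⟨v, hv.2, hv.apply_eq_smul⟩

theorem exists_notMem_span_pair (u v : E3) : ∃ w, w ∉ Submodule.span ℝ {u, v} := by
  by_contra! h
  have htop : Submodule.span ℝ {u, v} = ⊤ := Submodule.eq_top_iff'.2 h
  have h1 := finrank_range_le_card (R := ℝ) ![u, v]
  rw [Matrix.range_cons, Matrix.range_cons, Matrix.range_empty, Set.union_empty,
    Set.singleton_union, Set.finrank, htop] at h1
  simp at h1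

namespace IsRegularConvexCone

variable {K : Set E3} {hc : IsClosed K} {A : E3 →L[ℝ] E3}

/-- The rank is one or two. A third independent vector is found in the kernel or in the range; in
the latter case `1 - A` is the rank-one projection. -/
theorem listed_of_idempotent (hK : IsRegularConvexCone K) (hA : A ∈ coneAutLie K hc)
    (h : ∀ x, A (A x) = A x) {u v : E3} (hu : A u = u) (hu0 : u ≠ 0) (hv : A v = 0) (hv0 : v ≠ 0) :
    ∃ T : ConeType, ConeIsomorphic K T.cone := by
  have hI : ∀ {w}, w ∉ Submodule.span ℝ {u, v} → Indep3 u v w := by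
    intro w hw a b c e
    have hc : c = 0 := by
      by_contra hc
      refine hw (Submodule.mem_span_pair.2 ⟨-a / c, -b / c, ?_⟩)
      have : w = c⁻¹ • ((a • u + b • v + c • w) - a • u - b • v) := by
        match_scalars <;> field_simp <;> ring
      rw [this, e]
      match_scalars <;> field_simp
    subst hc
    have ha : a • u = 0 := by simpa [hu, hv] using congrArg A e
    have ha := (smul_eq_zero.1 ha).resolve_right hu0
    subst ha
    exact ⟨rfl, by simpa [hv0] using e, rfl⟩
  obtain ⟨w, hw⟩ := exists_notMem_span_pair u v
  by_cases hAw : A w ∈ Submodule.span ℝ {u, v}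
  · have hn : w - A w ∉ Submodule.span ℝ {u, v} := fun hcon => hw (by
      simpa using Submodule.add_mem _ hcon hAw)
    exact listed_of_projection hK hA (hI hn) hu hv (by simp [h])
  · refine listed_of_projection hK (A := 1 - A)
      (Submodule.sub_mem _ (one_mem_coneAutLie hK) hA) (hI hAw).swap01 ?_ ?_ ?_
    · simp [hv]
    · simp [hu]
    · simp [h]

/-- Eigenvalue 1 and double eigenvalue 0. Either `A` is idempotent, or `A x - x` and its image form
a Jordan chain for 0. -/
theorem listed_of_double_eigenvalue (hK : IsRegularConvexCone K) (hA : A ∈ coneAutLie K hc)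
    (h : ∀ x, A (A (A x)) = A (A x)) {v : E3} (hv : A v = v) (hv0 : v ≠ 0) (h1 : A ≠ 1) :
    ∃ T : ConeType, ConeIsomorphic K T.cone := by
  by_cases h2 : ∀ x, A (A x) = A x
  · obtain ⟨y, hy⟩ : ∃ y, A y ≠ y := by
      by_contra! hcon
      exact h1 (ContinuousLinearMap.ext hcon)
    exact listed_of_idempotent hK hA h2 hv hv0 (v := A y - y) (by simp [h2]) (sub_ne_zero.2 hy)
  · push Not at h2
    obtain ⟨x, hx⟩ := h2
    have hI : Indep3 (A (A x) - A x) v (A x - x) := by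
      intro a b c e
      have e2 : b • v = 0 := by simpa [hv, h] using congrArg (fun y => A (A y)) e
      have hb := (smul_eq_zero.1 e2).resolve_right hv0
      subst hb
      have e1 : c • (A (A x) - A x) = 0 := by simpa [h] using congrArg A e
      have hc := (smul_eq_zero.1 e1).resolve_right (sub_ne_zero.2 hx)
      subst hc
      have e0 : a • (A (A x) - A x) = 0 := by simpa using e
      exact ⟨(smul_eq_zero.1 e0).resolve_right (sub_ne_zero.2 hx), rfl, rfl⟩
    exact listed_of_jordan hK hA hI (by simp [h]) hv (by simp)

theorem listed_of_cube_eq_zero (hK : IsRegularConvexCone K) (hA : A ∈ coneAutLie K hc)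
    (h : ∀ x, A (A (A x)) = 0) (h0 : A ≠ 0) : ∃ T : ConeType, ConeIsomorphic K T.cone := by
  obtain ⟨x, hx⟩ : ∃ x, A (A x) ≠ 0 := by
    by_contra! hcon
    exact h0 (eq_zero_of_sq_eq_zero hK hA hcon)
  have hI : Indep3 (A (A x)) (A x) x := by
    intro a b c e
    have e2 : c • A (A x) = 0 := by simpa [h] using congrArg (fun y => A (A y)) e
    have hc := (smul_eq_zero.1 e2).resolve_right hx
    subst hc
    have e1 : b • A (A x) = 0 := by simpa [h] using congrArg A e
    have hb := (smul_eq_zero.1 e1).resolve_right hx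
    subst hb
    have e0 : a • A (A x) = 0 := by simpa using e
    exact ⟨(smul_eq_zero.1 e0).resolve_right hx, rfl, rfl⟩
  exact listed_of_nilpotent hK hA hI (h x) rfl rfl

/-- Here `(A - δ)(A² + 1) = 0`, so `A x - δ x` lies in the plane on which `A` is a quarter-turn. -/
theorem listed_of_complex_eigenvalue (hK : IsRegularConvexCone K) (hA : A ∈ coneAutLie K hc)
    {δ : ℝ} (h : ∀ x, A (A (A x) + x) = δ • (A (A x) + x)) (hsc : ∀ r : ℝ, A ≠ r • 1) {v : E3}
    (hv : A v = δ • v) (hv0 : v ≠ 0) : ∃ T : ConeType, ConeIsomorphic K T.cone := by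
  obtain ⟨x, hx⟩ : ∃ x, A x - δ • x ≠ 0 := by
    by_contra! hcon
    refine hsc δ (ContinuousLinearMap.ext fun x => ?_)
    simpa using sub_eq_zero.1 (hcon x)
  set w := A x - δ • x with hw
  have hww : A (A w) = -w := by
    have := h x
    rw [hw]
    simp only [map_sub, map_smul, map_add] at this ⊢
    linear_combination (norm := module) this
  have hI : Indep3 v w (A w) := by
    intro a b c e
    have e2 : (a * (δ ^ 2 + 1)) • v = 0 := by
      have h1 := congrArg (fun y => A (A y) + y) e
      simp only [map_add, map_smul, hv, hww, map_zero, add_zero, map_neg] at h1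
      rw [← h1]
      module
    have ha : a = 0 := by
      rcases mul_eq_zero.1 ((smul_eq_zero.1 e2).resolve_right hv0) with ha | ha
      · exact ha
      · nlinarith [sq_nonneg δ]
    subst ha
    have e1 : (b ^ 2 + c ^ 2) • w = 0 := by
      have h1 := congrArg A e
      simp only [map_add, map_smul, hv, hww, map_zero] at h1
      linear_combination (norm := module) b • e - c • h1
    have hbc := (smul_eq_zero.1 e1).resolve_right hx
    exact ⟨rfl, by nlinarith [sq_nonneg b, sq_nonneg c], by nlinarith [sq_nonneg b, sq_nonneg c]⟩
  exact listed_of_rotation hK hA hI hv rfl hww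

/-- Applying the product of two of the factors `A - a`, `A - b`, `A - c` to a linear relation leaves
a single eigenvector. -/
theorem indep3_of_eigenvectors {a b c : ℝ} {u v w : E3} (hu : A u = a • u) (hv : A v = b • v)
    (hw : A w = c • w) (hu0 : u ≠ 0) (hv0 : v ≠ 0) (hw0 : w ≠ 0) (hab : a ≠ b) (hac : a ≠ c)
    (hbc : b ≠ c) : Indep3 u v w := by
  intro x y z e
  have e1 := congrArg A e
  have e2 := congrArg A e1
  simp only [map_add, map_smul, hu, hv, hw, map_zero] at e1 e2
  have hx : (x * ((a - b) * (a - c))) • u = 0 := by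
    linear_combination (norm := module) e2 - (b + c) • e1 + (b * c) • e
  have hy : (y * ((b - a) * (b - c))) • v = 0 := by
    linear_combination (norm := module) e2 - (a + c) • e1 + (a * c) • e
  have hz : (z * ((c - a) * (c - b))) • w = 0 := by
    linear_combination (norm := module) e2 - (a + b) • e1 + (a * b) • e
  refine ⟨?_, ?_, ?_⟩
  · simpa [hu0, sub_ne_zero.2 hab, sub_ne_zero.2 hac] using hx
  · simpa [hv0, sub_ne_zero.2 hab.symm, sub_ne_zero.2 hbc] using hy
  · simpa [hw0, sub_ne_zero.2 hac.symm, sub_ne_zero.2 hbc.symm] using hz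

theorem listed_of_distinct_eigenvalues (hK : IsRegularConvexCone K) (hA : A ∈ coneAutLie K hc)
    {a b c : ℝ} {u v w : E3} (hu : A u = a • u) (hv : A v = b • v)
    (hw : A w = c • w) (hu0 : u ≠ 0) (hv0 : v ≠ 0) (hw0 : w ≠ 0) (hab : a ≠ b) (hac : a ≠ c)
    (hbc : b ≠ c) : ∃ T : ConeType, ConeIsomorphic K T.cone := by
  have hI := indep3_of_eigenvectors hu hv hw hu0 hv0 hw0 hab hac hbc
  rcases hab.lt_or_gt with h1 | h1 <;> rcases hac.lt_or_gt with h2 | h2 <;>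
    rcases hbc.lt_or_gt with h3 | h3
  · exact listed_of_diagonal hK hA hI.swap02 hw hv hu h3 h1
  · exact listed_of_diagonal hK hA hI.swap02.swap01 hv hw hu h3 h2
  · linarith
  · exact listed_of_diagonal hK hA hI.swap01 hv hu hw h1 h2
  · exact listed_of_diagonal hK hA hI.swap02.swap12 hw hu hv h2 h1
  · linarith
  · exact listed_of_diagonal hK hA hI.swap12 hu hw hv h2 h3
  · exact listed_of_diagonal hK hA hI hu hv hw h1 h3

theorem listed_of_double_root (hK : IsRegularConvexCone K) (hA : A ∈ coneAutLie K hc)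
    (hsc : ∀ r : ℝ, A ≠ r • 1) {a c : ℝ} (hac : c ≠ a)
    (h : ∀ x, A (A (A x)) - (2 * a + c) • A (A x) + (a ^ 2 + 2 * a * c) • A x -
      (a ^ 2 * c) • x = 0) {v : E3} (hv : A v = c • v) (hv0 : v ≠ 0) :
    ∃ T : ConeType, ConeIsomorphic K T.cone := by
  have hd : c - a ≠ 0 := sub_ne_zero.2 hac
  set T := (c - a)⁻¹ • (A - a • 1) with hT
  have hTA : A = (c - a) • T + a • 1 := by rw [hT, smul_inv_smul₀ hd, sub_add_cancel]
  have hTL : T ∈ coneAutLie K hc := Submodule.smul_mem _ _ (Submodule.sub_mem _ hA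
      (Submodule.smul_mem _ _ (one_mem_coneAutLie hK)))
  clear_value T
  refine listed_of_double_eigenvalue hK hTL (fun x => ?_) (v := v) ?_ hv0 ?_
  · have h1 := h x
    simp only [hTA, add_apply, smul_apply, one_apply_eq_self, map_add, map_smul] at h1
    have h2 : (c - a) ^ 3 • (T (T (T x)) - T (T x)) = 0 := by
      rw [← h1]; module
    exact sub_eq_zero.1 ((smul_eq_zero.1 h2).resolve_left (pow_ne_zero 3 hd))
  · rw [hTA, add_apply, smul_apply, smul_apply, one_apply_eq_self] at hv
    have h2 : (c - a) • (T v - v) = 0 := by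
      linear_combination (norm := module) hv
    exact sub_eq_zero.1 ((smul_eq_zero.1 h2).resolve_left hd)
  · rintro rfl
    refine hsc c ?_
    rw [hTA]
    module

theorem exists_listed (hK : IsRegularConvexCone K) (hA : A ∈ coneAutLie K hc)
    (hsc : ∀ r : ℝ, A ≠ r • 1) : ∃ T : ConeType, ConeIsomorphic K T.cone := by
  obtain ⟨l, b, c, hp⟩ := exists_charpoly_eq (A : E3 →ₗ[ℝ] E3)
  have hCH : ∀ x, A (A (A x) + b • A x + c • x) - l • (A (A x) + b • A x + c • x) = 0 := by
    intro x
    have h1 := (A : E3 →ₗ[ℝ] E3).aeval_self_charpoly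
    rw [hp] at h1
    have h2 := congrArg (fun f : E3 →ₗ[ℝ] E3 => f x) h1
    simpa [pow_two, Module.algebraMap_end_apply] using h2
  have hev : ∀ r, (r - l) * (r ^ 2 + b * r + c) = 0 → ∃ v, v ≠ 0 ∧ A v = r • v := by
    intro r hr
    refine exists_eigenvector (f := (A : E3 →ₗ[ℝ] E3)) ?_
    rw [hp]
    simpa [Polynomial.IsRoot] using hr
  have h1L := one_mem_coneAutLie (hc := hc) hK
  rcases lt_or_ge 0 (c - b ^ 2 / 4) with hd | hd
  · obtain ⟨ω, hω, hωd⟩ : ∃ ω : ℝ, 0 < ω ∧ ω ^ 2 = c - b ^ 2 / 4 :=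
      ⟨√(c - b ^ 2 / 4), Real.sqrt_pos.2 hd, Real.sq_sqrt hd.le⟩
    obtain ⟨a, rfl⟩ : ∃ a, b = -2 * a := ⟨-b / 2, by ring⟩
    obtain rfl : c = a ^ 2 + ω ^ 2 := by rw [hωd]; ring
    -- The complex roots are `a ± iω`, so `(A - a)/ω` has eigenvalues `±i` and `δ`.
    obtain ⟨δ, rfl⟩ : ∃ δ, l = a + ω * δ := ⟨(l - a) / ω, by field_simp; ring⟩
    obtain ⟨v, hv0, hv⟩ := hev (a + ω * δ) (by ring)
    set T := ω⁻¹ • (A - a • 1) with hT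
    have hTA : A = ω • T + a • 1 := by rw [hT, smul_inv_smul₀ hω.ne', sub_add_cancel]
    have hTL : T ∈ coneAutLie K hc := Submodule.smul_mem _ _ (Submodule.sub_mem _ hA
      (Submodule.smul_mem _ _ h1L))
    clear_value T
    refine listed_of_complex_eigenvalue hK hTL (δ := δ) (fun x => ?_) (fun r hr => ?_) (v := v)
      ?_ hv0
    · have h1 := hCH x
      simp only [hTA, add_apply, smul_apply, one_apply_eq_self, map_add, map_smul] at h1 ⊢
      have h2 : ω ^ 3 • (T (T (T x)) + T x - δ • (T (T x) + x)) = 0 := by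
        rw [← h1]; module
      exact sub_eq_zero.1 ((smul_eq_zero.1 h2).resolve_left (pow_ne_zero 3 hω.ne'))
    · refine hsc (ω * r + a) ?_
      rw [hTA, hr]
      module
    · rw [hTA, add_apply, smul_apply, smul_apply, one_apply_eq_self] at hv
      have h2 : ω • (T v - δ • v) = 0 := by
        linear_combination (norm := module) hv
      exact sub_eq_zero.1 ((smul_eq_zero.1 h2).resolve_left hω.ne')
  · obtain ⟨r, s, rfl, rfl⟩ : ∃ r s : ℝ, b = -(r + s) ∧ c = r * s := by
      have h2 := Real.sq_sqrt (show 0 ≤ b ^ 2 / 4 - c by linarith)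
      exact ⟨-b / 2 + √(b ^ 2 / 4 - c), -b / 2 - √(b ^ 2 / 4 - c), by ring, by linarith⟩
    obtain ⟨u, hu0, hu⟩ := hev l (by ring)
    obtain ⟨v, hv0, hv⟩ := hev r (by ring)
    obtain ⟨w, hw0, hw⟩ := hev s (by ring)
    simp only [map_add, map_smul] at hCH
    by_cases hlr : l = r
    · subst hlr
      by_cases hls : l = s
      · subst hls
        refine listed_of_cube_eq_zero hK (A := A - l • 1) (Submodule.sub_mem _ hA
          (Submodule.smul_mem _ _ h1L)) (fun x => ?_) (sub_ne_zero.2 (hsc l))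
        rw [← hCH x]
        simp only [sub_apply, smul_apply, one_apply_eq_self, map_sub, map_smul]
        module
      · refine listed_of_double_root hK hA hsc (a := l) (c := s) (Ne.symm hls) (fun x => ?_) hw hw0
        rw [← hCH x]
        module
    · by_cases hls : l = s
      · subst hls
        refine listed_of_double_root hK hA hsc (a := l) (c := r) (Ne.symm hlr) (fun x => ?_) hv hv0
        rw [← hCH x]
        module
      · by_cases hrs : r = s
        · subst hrs
          refine listed_of_double_root hK hA hsc (a := r) (c := l) hlr (fun x => ?_) hu hu0
          rw [← hCH x]
          module
        · exact listed_of_distinct_eigenvalues hK hA hu hv hw hu0 hv0 hw0 hlr hls hrs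

end IsRegularConvexCone

/-! ### Linear vector fields tangent to a cone -/

/-- The linear vector field `B` generates motions inside `K` through each of its points. -/
def FlowTangent (K : Set E3) (B : E3 →ₗ[ℝ] E3) : Prop :=
  ∀ x ∈ K, ∃ γ : ℝ → E3, (∀ t, γ t ∈ K) ∧ γ 0 = x ∧ HasDerivAt γ (B x) 0

/-- The matrix entries of a linear map of `ℝ³`. -/
noncomputable def entry (B : E3 →ₗ[ℝ] E3) (i j : Fin 3) : ℝ := B (EuclideanSpace.single j 1) i

theorem apply_eq_entry (B : E3 →ₗ[ℝ] E3) (x : E3) (i : Fin 3) :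
    B x i = x 0 * entry B i 0 + x 1 * entry B i 1 + x 2 * entry B i 2 := by
  have hx : x = x 0 • EuclideanSpace.single 0 (1 : ℝ) + x 1 • EuclideanSpace.single 1 (1 : ℝ) +
      x 2 • EuclideanSpace.single 2 (1 : ℝ) := by
    ext i; fin_cases i <;> simp
  conv_lhs => rw [hx]
  simp [entry]

theorem vec_ext {x y : E3} (h0 : x 0 = y 0) (h1 : x 1 = y 1) (h2 : x 2 = y 2) : x = y := by
  ext i; fin_cases i <;> assumption

theorem hasDerivAt_vec {f g h : ℝ → ℝ} {f' g' h' t : ℝ} (hf : HasDerivAt f f' t)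
    (hg : HasDerivAt g g' t) (hh : HasDerivAt h h' t) :
    HasDerivAt (fun t => (!₂[f t, g t, h t] : E3)) !₂[f', g', h'] t := by
  have h1 : HasDerivAt (fun t => ![f t, g t, h t]) ![f', g', h'] t := by
    rw [hasDerivAt_pi]
    intro i
    fin_cases i <;> assumption
  exact (PiLp.continuousLinearEquiv 2 ℝ (fun _ : Fin 3 => ℝ)).symm.hasFDerivAt.comp_hasDerivAt t h1

theorem HasDerivAt.coord {γ : ℝ → E3} {w : E3} {t : ℝ} (h : HasDerivAt γ w t) (i : Fin 3) :
    HasDerivAt (fun t => γ t i) (w i) t :=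
  (EuclideanSpace.proj i : E3 →L[ℝ] ℝ).hasFDerivAt.comp_hasDerivAt t h

theorem FlowTangent.conj {K : Set E3} {B : E3 →ₗ[ℝ] E3} (h : FlowTangent K B) (S : E3 ≃L[ℝ] E3) :
    FlowTangent (S '' K) ((S : E3 →ₗ[ℝ] E3) ∘ₗ B ∘ₗ (S.symm : E3 →ₗ[ℝ] E3)) := by
  rintro _ ⟨x, hx, rfl⟩
  obtain ⟨γ, hγ, hγ0, hγ'⟩ := h x hx
  refine ⟨fun t => S (γ t), fun t => ⟨_, hγ t, rfl⟩, by simp [hγ0], ?_⟩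
  have e : ((S : E3 →ₗ[ℝ] E3) ∘ₗ B ∘ₗ (S.symm : E3 →ₗ[ℝ] E3)) (S x) = S (B x) := by simp
  rw [e]
  exact S.hasFDerivAt.comp_hasDerivAt 0 hγ'

/-- The motion is defined for times of both signs, so a nonnegative coordinate that vanishes at time
0 has a minimum there. -/
theorem FlowTangent.apply_eq_zero {K : Set E3} {B : E3 →ₗ[ℝ] E3} (h : FlowTangent K B) {i : Fin 3}
    (hi : ∀ x ∈ K, 0 ≤ x i) {x : E3} (hx : x ∈ K) (hxi : x i = 0) : B x i = 0 := by
  obtain ⟨γ, hγ, hγ0, hγ'⟩ := h x hx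
  refine IsLocalMin.hasDerivAt_eq_zero (Eventually.of_forall fun t => ?_) (hγ'.coord i)
  rw [hγ0, hxi]
  exact hi _ (hγ t)

/-- First-order condition at a boundary point on the surface `x₂ = β x₁^θ x₃^(1-θ)`. -/
theorem FlowTangent.power_eq {K : Set E3} {B : E3 →ₗ[ℝ] E3} (h : FlowTangent K B) {σ β θ u : ℝ}
    (hσ : σ ≠ 0)
    (hK : ∀ x ∈ K, 0 < x 0 → 0 < x 2 → 0 ≤ σ * (β * (x 0 ^ θ * x 2 ^ (1 - θ)) - x 1)) (hu : 0 < u)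
    (hx : !₂[u, β * u ^ θ, 1] ∈ K) :
    β * (θ * u ^ (θ - 1) * B !₂[u, β * u ^ θ, 1] 0 + (1 - θ) * u ^ θ * B !₂[u, β * u ^ θ, 1] 2) =
      B !₂[u, β * u ^ θ, 1] 1 := by
  obtain ⟨γ, hγ, hγ0, hγ'⟩ := h _ hx
  set w := B !₂[u, β * u ^ θ, 1]
  have h0 := hγ'.coord 0
  have h1 := hγ'.coord 1
  have h2 := hγ'.coord 2
  have e0 : γ 0 0 = u := by rw [hγ0]; rfl
  have e1 : γ 0 1 = β * u ^ θ := by rw [hγ0]; rfl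
  have e2 : γ 0 2 = 1 := by rw [hγ0]; rfl
  -- This function of time vanishes at 0 and is nonnegative nearby, so its derivative is zero. The
  -- sign of `σ` distinguishes upper from lower boundary surfaces.
  have hd := (((h0.rpow_const (p := θ) (Or.inl (by rw [e0]; exact hu.ne'))).mul
    (h2.rpow_const (p := 1 - θ) (Or.inl (by rw [e2]; norm_num)))).const_mul β |>.sub h1).const_mul σ
  have hz := IsLocalMin.hasDerivAt_eq_zero (f := fun t =>
    σ * (β * (γ t 0 ^ θ * γ t 2 ^ (1 - θ)) - γ t 1)) (a := 0) ?_ hd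
  · simp only [e0, e2, Real.one_rpow, mul_one] at hz
    have := (mul_eq_zero.1 hz).resolve_left hσ
    linear_combination this
  · have hp0 : ∀ᶠ t in 𝓝 0, 0 < γ t 0 :=
      h0.continuousAt.eventually_const_lt (by simpa only [e0] using hu)
    have hp2 : ∀ᶠ t in 𝓝 0, 0 < γ t 2 :=
      h2.continuousAt.eventually_const_lt (by simp only [e2, zero_lt_one])
    filter_upwards [hp0, hp2] with t ht0 ht2
    rw [e0, e1, e2, Real.one_rpow, mul_one, sub_self, mul_zero]
    exact hK _ (hγ t) ht0 ht2

/-- Exponential functions with distinct rates are linearly independent. -/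
theorem eq_zero_of_sum_exp_eq_zero {n : ℕ} {r c : Fin n → ℝ} (hr : Function.Injective r)
    (h : ∀ t : ℝ, ∑ i, c i * Real.exp (r i * t) = 0) (i : Fin n) : c i = 0 := by
  -- The exponentials are characters of the additive group of `ℝ`, written multiplicatively, so
  -- Dedekind's independence of characters applies.
  let χ : ℝ → (Multiplicative ℝ →* ℝ) := fun a =>
    { toFun := fun t => Real.exp (a * t.toAdd)
      map_one' := by simp
      map_mul' := fun s t => by rw [toAdd_mul, mul_add, Real.exp_add] }
  have hχ : Function.Injective χ := by
    intro a b hab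
    have := DFunLike.congr_fun hab (Multiplicative.ofAdd 1)
    simpa [χ] using this
  have hli := (linearIndependent_monoidHom (Multiplicative ℝ) ℝ).comp (fun i => χ (r i))
    (hχ.comp hr)
  rw [Fintype.linearIndependent_iff] at hli
  refine hli c ?_ i
  funext t
  simpa [χ] using h t.toAdd

section Tangency

variable {K : Set E3} {B : E3 →ₗ[ℝ] E3} {σ β θ : ℝ}

/-- The condition of `FlowTangent.power_eq` at `u = exp t`, expanded in the matrix entries: each
entry enters with a definite exponential rate. -/
theorem FlowTangent.power_exp_eq (h : FlowTangent K B) (hσ : σ ≠ 0)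
    (hK : ∀ x ∈ K, 0 < x 0 → 0 < x 2 → 0 ≤ σ * (β * (x 0 ^ θ * x 2 ^ (1 - θ)) - x 1))
    (hx : ∀ u : ℝ, 0 < u → !₂[u, β * u ^ θ, 1] ∈ K) (t : ℝ) :
    β * θ * entry B 0 2 * Real.exp ((θ - 1) * t) +
      β ^ 2 * θ * entry B 0 1 * Real.exp ((2 * θ - 1) * t) +
      -entry B 1 2 * Real.exp (0 * t) +
      β * (θ * entry B 0 0 + (1 - θ) * entry B 2 2 - entry B 1 1) * Real.exp (θ * t) +
      β ^ 2 * (1 - θ) * entry B 2 1 * Real.exp (2 * θ * t) +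
      -entry B 1 0 * Real.exp (1 * t) +
      β * (1 - θ) * entry B 2 0 * Real.exp ((θ + 1) * t) = 0 := by
  have h1 := h.power_eq hσ hK (Real.exp_pos t) (hx _ (Real.exp_pos t))
  rw [apply_eq_entry, apply_eq_entry, apply_eq_entry] at h1
  have e0 : ∀ a b : ℝ, (!₂[a, b, 1] : E3) 0 = a := fun _ _ => rfl
  have e1 : ∀ a b : ℝ, (!₂[a, b, 1] : E3) 1 = b := fun _ _ => rfl
  have e2 : ∀ a b : ℝ, (!₂[a, b, 1] : E3) 2 = 1 := fun _ _ => rfl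
  rw [e0, e1, e2, ← Real.exp_mul, ← Real.exp_mul] at h1
  have a1 : Real.exp ((θ - 1) * t) = Real.exp (t * θ) * (Real.exp t)⁻¹ := by
    rw [← Real.exp_neg, ← Real.exp_add]; ring_nf
  have a2 : Real.exp ((2 * θ - 1) * t) = Real.exp (t * θ) ^ 2 * (Real.exp t)⁻¹ := by
    rw [pow_two, ← Real.exp_neg, ← Real.exp_add, ← Real.exp_add]; ring_nf
  have a3 : Real.exp (2 * θ * t) = Real.exp (t * θ) ^ 2 := by
    rw [pow_two, ← Real.exp_add]; ring_nf
  have a4 : Real.exp ((θ + 1) * t) = Real.exp (t * θ) * Real.exp t := by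
    rw [← Real.exp_add]; ring_nf
  have a5 : Real.exp (t * (θ - 1)) = Real.exp (t * θ) * (Real.exp t)⁻¹ := by
    rw [← a1]; ring_nf
  rw [a1, a2, a3, a4, zero_mul, Real.exp_zero, one_mul, mul_comm θ t]
  rw [a5] at h1
  have hne := (Real.exp_pos t).ne'
  field_simp at h1 ⊢
  linear_combination h1

/-- For `θ < 1/2` the seven rates are distinct and in increasing order, so all coefficients vanish.
-/
theorem FlowTangent.entries_of_lt_half (h : FlowTangent K B) (hσ : σ ≠ 0)
    (hK : ∀ x ∈ K, 0 < x 0 → 0 < x 2 → 0 ≤ σ * (β * (x 0 ^ θ * x 2 ^ (1 - θ)) - x 1))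
    (hx : ∀ u : ℝ, 0 < u → !₂[u, β * u ^ θ, 1] ∈ K) (hθ : 0 < θ) (hθ' : θ < 1 / 2) (hβ : β ≠ 0) :
    entry B 0 1 = 0 ∧ entry B 0 2 = 0 ∧ entry B 1 0 = 0 ∧ entry B 1 2 = 0 ∧ entry B 2 0 = 0 ∧
      entry B 2 1 = 0 ∧ entry B 1 1 = θ * entry B 0 0 + (1 - θ) * entry B 2 2 := by
  have hr : StrictMono ![θ - 1, 2 * θ - 1, 0, θ, 2 * θ, 1, θ + 1] := by
    rw [Fin.strictMono_iff_lt_succ]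
    intro i
    fin_cases i <;> simp <;> linarith
  have hc := eq_zero_of_sum_exp_eq_zero (c := ![β * θ * entry B 0 2, β ^ 2 * θ * entry B 0 1,
    -entry B 1 2, β * (θ * entry B 0 0 + (1 - θ) * entry B 2 2 - entry B 1 1),
    β ^ 2 * (1 - θ) * entry B 2 1, -entry B 1 0, β * (1 - θ) * entry B 2 0]) hr.injective
    (fun t => by
      refine Eq.trans ?_ (h.power_exp_eq hσ hK hx t)
      simp [Fin.sum_univ_succ]
      ring)
  have c0 := hc 0
  have c1 := hc 1
  have c2 := hc 2
  have c3 := hc 3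
  have c4 := hc 4
  have c5 := hc 5
  have c6 := hc 6
  have hθ1 : 1 - θ ≠ 0 := by linarith
  simp [hβ, hθ.ne', hθ1] at c0 c1 c2 c3 c4 c5 c6
  exact ⟨c1, c0, c5, c2, c6, c4, by linarith⟩

/-- For `θ = 1/2` the rates `2θ - 1` and `0` coincide, as do `2θ` and `1`. Two pairs of entries are
then only related to each other, and a second piece of the boundary is needed to separate them. -/
theorem FlowTangent.entries_of_half (h : FlowTangent K B) (hσ : σ ≠ 0)
    (hK : ∀ x ∈ K, 0 < x 0 → 0 < x 2 →
      0 ≤ σ * (β * (x 0 ^ (1 / 2 : ℝ) * x 2 ^ (1 - 1 / 2 : ℝ)) - x 1))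
    (hx : ∀ u : ℝ, 0 < u → !₂[u, β * u ^ (1 / 2 : ℝ), 1] ∈ K) :
    β * entry B 0 2 = 0 ∧ β * entry B 2 0 = 0 ∧ entry B 1 2 = β ^ 2 / 2 * entry B 0 1 ∧
      entry B 1 0 = β ^ 2 / 2 * entry B 2 1 ∧
      β * (entry B 1 1 - (1 / 2 * entry B 0 0 + (1 - 1 / 2) * entry B 2 2)) = 0 := by
  have hr : StrictMono ![-(1 / 2 : ℝ), 0, 1 / 2, 1, 3 / 2] := by
    rw [Fin.strictMono_iff_lt_succ]
    intro i
    fin_cases i <;> simp <;> norm_num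
  have hc := eq_zero_of_sum_exp_eq_zero (c := ![β * entry B 0 2 / 2,
    β ^ 2 / 2 * entry B 0 1 - entry B 1 2,
    β * (1 / 2 * entry B 0 0 + (1 - 1 / 2) * entry B 2 2 - entry B 1 1),
    β ^ 2 / 2 * entry B 2 1 - entry B 1 0, β * entry B 2 0 / 2]) hr.injective
    (fun t => by
      have := h.power_exp_eq hσ hK hx t
      norm_num at this
      refine Eq.trans ?_ this
      norm_num [Fin.sum_univ_succ]
      ring)
  have c0 := hc 0
  have c1 := hc 1
  have c2 := hc 2
  have c3 := hc 3
  have c4 := hc 4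
  simp only [Matrix.cons_val] at c0 c1 c2 c3 c4
  exact ⟨by linarith, by linarith, by linarith, by linarith, by linarith⟩

end Tangency

/-! ### Rigidity and profiles -/

/-- All vector fields tangent to `K` are diagonal. -/
def HasDiagonalFlows (K : Set E3) : Prop :=
  ∀ B : E3 →ₗ[ℝ] E3, FlowTangent K B → ∀ i j : Fin 3, i ≠ j → entry B i j = 0

/-- All vector fields tangent to `K` are diagonal, and the middle rate is the mean of the outer
rates with weight `θ`. -/
def IsRigid (K : Set E3) (θ : ℝ) : Prop :=
  HasDiagonalFlows K ∧ ∀ B : E3 →ₗ[ℝ] E3, FlowTangent K B →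
    entry B 1 1 = θ * entry B 0 0 + (1 - θ) * entry B 2 2

theorem isRigid_of_entries {K : Set E3} {θ : ℝ} (h : ∀ B : E3 →ₗ[ℝ] E3, FlowTangent K B →
    entry B 0 1 = 0 ∧ entry B 0 2 = 0 ∧ entry B 1 0 = 0 ∧ entry B 1 2 = 0 ∧ entry B 2 0 = 0 ∧
      entry B 2 1 = 0 ∧ entry B 1 1 = θ * entry B 0 0 + (1 - θ) * entry B 2 2) : IsRigid K θ := by
  refine ⟨fun B hB i j hij => ?_, fun B hB => (h B hB).2.2.2.2.2.2⟩
  obtain ⟨h01, h02, h10, h12, h20, h21, -⟩ := h B hB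
  fin_cases i <;> fin_cases j <;> first | exact absurd rfl hij | assumption

/-- The diagonal linear map of `ℝ³` with the given diagonal entries. -/
def diagonalMap (a b c : ℝ) : E3 →ₗ[ℝ] E3 where
  toFun x := !₂[a * x 0, b * x 1, c * x 2]
  map_add' x y := by ext i; fin_cases i <;> simp [mul_add]
  map_smul' r x := by ext i; fin_cases i <;> simp <;> ring

/-- The shape of `K` in the region `x₁, x₃ > 0` is `x₂ / (x₁^θ x₃^(1-θ)) ∈ I`, and the
corresponding flow acts on `K`. -/
structure HasProfile (K : Set E3) (θ : ℝ) (I : Set ℝ) : Prop where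
  nonneg : ∀ x ∈ K, 0 ≤ x 0 ∧ 0 ≤ x 2
  mem_iff : ∀ x : E3, 0 < x 0 → 0 < x 2 → (x ∈ K ↔ x 1 / (x 0 ^ θ * x 2 ^ (1 - θ)) ∈ I)
  flow : FlowTangent K (diagonalMap 1 θ 0)

theorem flowTangent_diagonalMap {K : Set E3} {θ : ℝ}
    (h : ∀ t : ℝ, ∀ x ∈ K, !₂[Real.exp t * x 0, Real.exp (θ * t) * x 1, x 2] ∈ K) :
    FlowTangent K (diagonalMap 1 θ 0) := by
  intro x hx
  refine ⟨fun t => !₂[Real.exp t * x 0, Real.exp (θ * t) * x 1, x 2], fun t => h t x hx, ?_, ?_⟩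
  · exact vec_ext (by simp) (by simp) (by simp)
  · have h1 : HasDerivAt (fun t => Real.exp (θ * t)) θ 0 := by
      have h0 : HasDerivAt (fun t : ℝ => θ * t) θ 0 := by
        simpa using (hasDerivAt_id (0 : ℝ)).const_mul θ
      simpa using h0.exp
    have h2 : HasDerivAt Real.exp 1 0 := by simpa using Real.hasDerivAt_exp 0
    convert hasDerivAt_vec (h2.mul_const (x 0)) (h1.mul_const (x 1)) (hasDerivAt_const 0 (x 2))
      using 1
    simp [diagonalMap]

theorem exp_rpow_scaling (θ t a c : ℝ) (ha : 0 ≤ a) :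
    (Real.exp t * a) ^ θ * c ^ (1 - θ) = Real.exp (θ * t) * (a ^ θ * c ^ (1 - θ)) := by
  rw [Real.mul_rpow (Real.exp_pos t).le ha, ← Real.exp_mul, mul_comm t, mul_assoc]

/-! ### Isomorphisms onto a rigid cone -/

section Conjugate

variable {K K' : Set E3} {S : E3 ≃L[ℝ] E3} {B : E3 →ₗ[ℝ] E3}

theorem exists_coord_ne {x : E3} (hx : x ≠ 0) : ∃ i, x i ≠ 0 := by
  by_contra! h
  exact hx (PiLp.ext h)

/-- A diagonal map transported to a cone with diagonal flows only. -/
theorem HasDiagonalFlows.coord_eq (hK' : HasDiagonalFlows K') (hS : S '' K = K')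
    (hB : FlowTangent K B) (x : E3) (i : Fin 3) :
    entry ((S : E3 →ₗ[ℝ] E3) ∘ₗ B ∘ₗ (S.symm : E3 →ₗ[ℝ] E3)) i i * S x i = S (B x) i := by
  have hC := hB.conj S
  rw [hS] at hC
  have hd := hK' _ hC
  have := apply_eq_entry ((S : E3 →ₗ[ℝ] E3) ∘ₗ B ∘ₗ (S.symm : E3 →ₗ[ℝ] E3)) (S x) i
  have e : ((S : E3 →ₗ[ℝ] E3) ∘ₗ B ∘ₗ (S.symm : E3 →ₗ[ℝ] E3)) (S x) = S (B x) := by simp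
  rw [e] at this
  rw [this]
  clear this hC e
  generalize (S : E3 →ₗ[ℝ] E3) ∘ₗ B ∘ₗ (S.symm : E3 →ₗ[ℝ] E3) = C at hd ⊢
  fin_cases i
  · simp [hd 0 1 (by decide), hd 0 2 (by decide), mul_comm]
  · simp [hd 1 0 (by decide), hd 1 2 (by decide), mul_comm]
  · simp [hd 2 0 (by decide), hd 2 1 (by decide), mul_comm]

/-- `S` carries the field `diag(1, θ, 0)` to a diagonal field on `K'` with the same eigenvalues, so
it permutes the coordinate axes. The mean relation with weight `θ'` places `θ` in the middle, so the
middle axis is preserved and `S` acts on profiles by scaling. Only the target needs to be rigid. -/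
theorem HasProfile.eq_of_image {θ θ' : ℝ} {I I' : Set ℝ} (hP : HasProfile K θ I)
    (hP' : HasProfile K' θ' I') (hR : IsRigid K' θ') (hS : S '' K = K') (hI : I.Nonempty)
    (hθ : 0 < θ) (hθ2 : θ ≤ 1 / 2) (hθ' : 0 < θ') (hθ2' : θ' ≤ 1 / 2) :
    θ = θ' ∧ ∃ k : ℝ, k ≠ 0 ∧ ∀ s, s ∈ I ↔ k * s ∈ I' := by
  have hC := hP.flow.conj S
  rw [hS] at hC
  have hmean := hR.2 _ hC
  have hcoord := hR.1.coord_eq hS hP.flow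
  set C := (S : E3 →ₗ[ℝ] E3) ∘ₗ diagonalMap 1 θ 0 ∘ₗ (S.symm : E3 →ₗ[ℝ] E3)
  have hev : ∀ j : Fin 3, diagonalMap 1 θ 0 (EuclideanSpace.single j 1) =
      (![1, θ, 0] j) • EuclideanSpace.single j (1 : ℝ) := by
    intro j
    fin_cases j <;> refine vec_ext ?_ ?_ ?_ <;> simp [diagonalMap]
  -- Both fields are diagonal, so a nonzero entry of `S` forces the corresponding eigenvalues to
  -- agree.
  have hrel : ∀ i j : Fin 3, S (EuclideanSpace.single j 1) i ≠ 0 → entry C i i = ![1, θ, 0] j := by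
    intro i j hne
    have := hcoord (EuclideanSpace.single j 1) i
    rw [hev, map_smul, PiLp.smul_apply, smul_eq_mul] at this
    exact mul_right_cancel₀ hne this
  have hex : ∀ j : Fin 3, ∃ i, entry C i i = ![1, θ, 0] j := by
    intro j
    obtain ⟨i, hi⟩ := exists_coord_ne (x := S (EuclideanSpace.single j 1)) (by simp)
    exact ⟨i, hrel i j hi⟩
  obtain ⟨i0, h0⟩ := hex 0
  obtain ⟨i1, h1⟩ := hex 1
  obtain ⟨i2, h2⟩ := hex 2
  simp only [Matrix.cons_val] at h0 h1 h2
  have hcases : (entry C 0 0 = 1 ∧ entry C 1 1 = θ ∧ entry C 2 2 = 0) ∨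
      (entry C 0 0 = 0 ∧ entry C 1 1 = θ ∧ entry C 2 2 = 1) := by
    fin_cases i0 <;> fin_cases i1 <;> fin_cases i2 <;>
      simp only [Fin.zero_eta, Fin.mk_one, Fin.reduceFinMk, Fin.isValue] at h0 h1 h2 <;>
      first
        | (exfalso; linarith)
        | exact Or.inl ⟨h0, h1, h2⟩
        | exact Or.inr ⟨h2, h1, h0⟩
        | (exfalso; rw [h0, h1, h2] at hmean; nlinarith)
  have hoff : ∀ i j : Fin 3, entry C i i ≠ ![1, θ, 0] j → S (EuclideanSpace.single j 1) i = 0 :=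
    fun i j h => by
      by_contra hne
      exact h (hrel i j hne)
  have hdiag : ∀ i j : Fin 3, (∀ i', i' ≠ i → S (EuclideanSpace.single j 1) i' = 0) →
      S (EuclideanSpace.single j 1) i ≠ 0 := by
    intro i j h hi
    obtain ⟨i', hi'⟩ := exists_coord_ne (x := S (EuclideanSpace.single j 1)) (by simp)
    by_cases hii : i' = i
    · exact hi' (hii ▸ hi)
    · exact hi' (h i' hii)
  have hvec : ∀ s : ℝ, ∀ i : Fin 3, S !₂[1, s, 1] i = S (EuclideanSpace.single 0 1) i +
      s * S (EuclideanSpace.single 1 1) i + S (EuclideanSpace.single 2 1) i := by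
    intro s i
    have : (!₂[1, s, 1] : E3) = EuclideanSpace.single 0 1 + s • EuclideanSpace.single 1 (1 : ℝ) +
        EuclideanSpace.single 2 1 := by
      refine vec_ext ?_ ?_ ?_ <;> simp
    rw [this]
    simp
  have hmid : ∀ i, i ≠ 1 → S (EuclideanSpace.single 1 1) i = 0 := by
    intro i hi
    refine hoff i 1 ?_
    rcases hcases with ⟨c0, c1, c2⟩ | ⟨c0, c1, c2⟩ <;> fin_cases i <;> simp at hi ⊢ <;>
      intro hcon <;> linarith
  have hmid1 := hdiag 1 1 hmid
  have hout : ∀ j, j ≠ 1 → S (EuclideanSpace.single j 1) 1 = 0 := by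
    intro j hj
    refine hoff 1 j ?_
    rcases hcases with ⟨c0, c1, c2⟩ | ⟨c0, c1, c2⟩ <;> fin_cases j <;> simp at hj ⊢ <;>
      intro hcon <;> linarith
  have key : ∃ a b c : ℝ, a ≠ 0 ∧ b ≠ 0 ∧ c ≠ 0 ∧ ∀ s, S !₂[1, s, 1] = !₂[a, b * s, c] := by
    rcases hcases with ⟨c0, c1, c2⟩ | ⟨c0, c1, c2⟩
    · have e20 : S (EuclideanSpace.single 0 1) 2 = 0 := hoff 2 0 (by simp [c2])
      have e02 : S (EuclideanSpace.single 2 1) 0 = 0 := hoff 0 2 (by simp [c0])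
      refine ⟨S (EuclideanSpace.single 0 1) 0, S (EuclideanSpace.single 1 1) 1,
        S (EuclideanSpace.single 2 1) 2, hdiag 0 0 ?_, hmid1, hdiag 2 2 ?_, fun s => ?_⟩
      · intro i hi
        fin_cases i
        · exact absurd rfl hi
        · exact hout 0 (by decide)
        · exact e20
      · intro i hi
        fin_cases i
        · exact e02
        · exact hout 2 (by decide)
        · exact absurd rfl hi
      · refine vec_ext ?_ ?_ ?_ <;> rw [hvec]
        · simp [e02, hmid 0 (by decide)]
        · simp [hout 0 (by decide), hout 2 (by decide), mul_comm]
        · simp [e20, hmid 2 (by decide)]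
    · have e00 : S (EuclideanSpace.single 0 1) 0 = 0 := hoff 0 0 (by simp [c0])
      have e22 : S (EuclideanSpace.single 2 1) 2 = 0 := hoff 2 2 (by simp [c2])
      refine ⟨S (EuclideanSpace.single 2 1) 0, S (EuclideanSpace.single 1 1) 1,
        S (EuclideanSpace.single 0 1) 2, hdiag 0 2 ?_, hmid1, hdiag 2 0 ?_, fun s => ?_⟩
      · intro i hi
        fin_cases i
        · exact absurd rfl hi
        · exact hout 2 (by decide)
        · exact e22
      · intro i hi
        fin_cases i
        · exact e00
        · exact hout 0 (by decide)
        · exact absurd rfl hi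
      · refine vec_ext ?_ ?_ ?_ <;> rw [hvec]
        · simp [e00, hmid 0 (by decide)]
        · simp [hout 0 (by decide), hout 2 (by decide), mul_comm]
        · simp [e22, hmid 2 (by decide)]
  refine ⟨?_, ?_⟩
  -- When the outer axes are exchanged, `θ = 1 - θ'`; as both are at most `1/2`, they are equal.
  · rcases hcases with ⟨c0, c1, c2⟩ | ⟨c0, c1, c2⟩ <;> rw [c0, c1, c2] at hmean <;> linarith
  obtain ⟨a, b, c, ha, hb, hc, hSv⟩ := key
  have hIK : ∀ s : ℝ, s ∈ I ↔ !₂[1, s, 1] ∈ K := by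
    intro s
    rw [hP.mem_iff _ (by simp) (by simp)]
    simp
  have hSK : ∀ x, S x ∈ K' ↔ x ∈ K := by
    intro x
    rw [← hS]
    exact S.injective.mem_set_image
  obtain ⟨s₀, hs₀⟩ := hI
  have hpos := hP'.nonneg _ ((hSK _).2 ((hIK s₀).1 hs₀))
  rw [hSv] at hpos
  have ha0 : 0 < a := lt_of_le_of_ne hpos.1 ha.symm
  have hc0 : 0 < c := lt_of_le_of_ne hpos.2 hc.symm
  -- The image of `(1, s, 1)` is `(a, b s, c)`, whose profile value is this constant times `s`.
  refine ⟨b / (a ^ θ' * c ^ (1 - θ')), by positivity, fun s => ?_⟩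
  rw [hIK, ← hSK, hSv, hP'.mem_iff _ (by simpa using ha0) (by simpa using hc0)]
  simp only [Matrix.cons_val]
  rw [div_mul_eq_mul_div]

end Conjugate

/-! ### Profiles and rigidity of the listed cones -/

section Lists

theorem powerExponents {p q : ℝ} (hp : 2 ≤ p) (hpq : 1 / p + 1 / q = 1) :
    1 / q = 1 - 1 / p ∧ 0 < 1 / p ∧ 1 / p ≤ 1 / 2 :=
  ⟨by linarith, by positivity, one_div_le_one_div_of_le two_pos hp⟩

theorem mem_powerHypographCone {p q : ℝ} (hp : 2 ≤ p) (hpq : 1 / p + 1 / q = 1) (x : E3) :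
    x ∈ powerHypographCone p q ↔ x 1 ≤ x 0 ^ (1 / p) * x 2 ^ (1 - 1 / p) ∧ 0 ≤ x 0 ∧ 0 ≤ x 2 := by
  rw [← (powerExponents hp hpq).1]; rfl

theorem mem_powerCone {p q α : ℝ} (hp : 2 ≤ p) (hpq : 1 / p + 1 / q = 1) (x : E3) :
    x ∈ powerCone p q α ↔ -α * (x 0 ^ (1 / p) * x 2 ^ (1 - 1 / p)) ≤ x 1 ∧
      x 1 ≤ x 0 ^ (1 / p) * x 2 ^ (1 - 1 / p) ∧ 0 ≤ x 0 ∧ 0 ≤ x 2 := by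
  rw [← (powerExponents hp hpq).1]; rfl

theorem mem_halfPowerCone {p q : ℝ} (hp : 2 ≤ p) (hpq : 1 / p + 1 / q = 1) (x : E3) :
    x ∈ halfPowerCone p q ↔ 0 ≤ x 1 ∧ x 1 ≤ x 0 ^ (1 / p) * x 2 ^ (1 - 1 / p) ∧
      0 ≤ x 0 ∧ 0 ≤ x 2 := by
  rw [← (powerExponents hp hpq).1]; rfl

variable {p q α : ℝ}

/-- The weight `θ` is free here, so the orthant can be compared with a power cone of any exponent.
-/
theorem hasProfile_orthantCone (θ : ℝ) : HasProfile orthantCone θ (Set.Ici 0) where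
  nonneg x hx := ⟨hx.1, hx.2.2⟩
  mem_iff x h0 h2 := by
    rw [Set.mem_Ici, le_div_iff₀ (by positivity), zero_mul]
    exact ⟨fun h => h.2.1, fun h => ⟨h0.le, h, h2.le⟩⟩
  flow := flowTangent_diagonalMap fun t x hx =>
    ⟨mul_nonneg (Real.exp_pos _).le hx.1, mul_nonneg (Real.exp_pos _).le hx.2.1, hx.2.2⟩

theorem hasProfile_powerHypographCone (hp : 2 ≤ p) (hpq : 1 / p + 1 / q = 1) :
    HasProfile (powerHypographCone p q) (1 / p) (Set.Iic 1) where
  nonneg x hx := hx.2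
  mem_iff x h0 h2 := by
    rw [mem_powerHypographCone hp hpq, Set.mem_Iic, div_le_one (by positivity)]
    simp [h0.le, h2.le]
  flow := flowTangent_diagonalMap fun t x hx => by
    rw [mem_powerHypographCone hp hpq] at hx ⊢
    simp only [Matrix.cons_val]
    rw [exp_rpow_scaling _ _ _ _ hx.2.1]
    exact ⟨mul_le_mul_of_nonneg_left hx.1 (Real.exp_pos _).le,
      mul_nonneg (Real.exp_pos _).le hx.2.1, hx.2.2⟩

theorem hasProfile_powerCone (hp : 2 ≤ p) (hpq : 1 / p + 1 / q = 1) :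
    HasProfile (powerCone p q α) (1 / p) (Set.Icc (-α) 1) where
  nonneg x hx := hx.2.2
  mem_iff x h0 h2 := by
    rw [mem_powerCone hp hpq, Set.mem_Icc, div_le_one (by positivity), le_div_iff₀ (by positivity)]
    simp [h0.le, h2.le]
  flow := flowTangent_diagonalMap fun t x hx => by
    rw [mem_powerCone hp hpq] at hx ⊢
    simp only [Matrix.cons_val]
    rw [exp_rpow_scaling _ _ _ _ hx.2.2.1, mul_left_comm]
    exact ⟨mul_le_mul_of_nonneg_left hx.1 (Real.exp_pos _).le,
      mul_le_mul_of_nonneg_left hx.2.1 (Real.exp_pos _).le,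
      mul_nonneg (Real.exp_pos _).le hx.2.2.1, hx.2.2.2⟩

theorem hasProfile_halfPowerCone (hp : 2 ≤ p) (hpq : 1 / p + 1 / q = 1) :
    HasProfile (halfPowerCone p q) (1 / p) (Set.Icc 0 1) where
  nonneg x hx := hx.2.2
  mem_iff x h0 h2 := by
    rw [mem_halfPowerCone hp hpq, Set.mem_Icc, div_le_one (by positivity),
      le_div_iff₀ (by positivity), zero_mul]
    simp [h0.le, h2.le]
  flow := flowTangent_diagonalMap fun t x hx => by
    rw [mem_halfPowerCone hp hpq] at hx ⊢
    simp only [Matrix.cons_val]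
    rw [exp_rpow_scaling _ _ _ _ hx.2.2.1]
    exact ⟨mul_nonneg (Real.exp_pos _).le hx.1,
      mul_le_mul_of_nonneg_left hx.2.1 (Real.exp_pos _).le,
      mul_nonneg (Real.exp_pos _).le hx.2.2.1, hx.2.2.2⟩

/-- For `i ≠ j` the axis vector `e_j` lies in the face `x_i = 0`, so the `i`-th component of a
tangent field vanishes there. -/
theorem hasDiagonalFlows_orthantCone : HasDiagonalFlows orthantCone := by
  intro B hB i j hij
  refine hB.apply_eq_zero (i := i) (fun x hx => ?_) (x := EuclideanSpace.single j 1) ?_ ?_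
  · obtain ⟨h0, h1, h2⟩ := hx
    fin_cases i <;> assumption
  · refine ⟨?_, ?_, ?_⟩ <;> fin_cases j <;> simp
  · simp [hij]

theorem isRigid_powerHypographCone (hp : 2 ≤ p) (hpq : 1 / p + 1 / q = 1) :
    IsRigid (powerHypographCone p q) (1 / p) := by
  obtain ⟨-, hθ, hθ'⟩ := powerExponents hp hpq
  have hmem := mem_powerHypographCone hp hpq
  refine isRigid_of_entries fun B hB => ?_
  generalize 1 / p = θ at hθ hθ' hmem ⊢
  have hK : ∀ x ∈ powerHypographCone p q, 0 < x 0 → 0 < x 2 →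
      0 ≤ 1 * (1 * (x 0 ^ θ * x 2 ^ (1 - θ)) - x 1) := fun x hx _ _ => by
    rw [hmem] at hx; linarith [hx.1]
  have hx : ∀ u : ℝ, 0 < u → !₂[u, 1 * u ^ θ, 1] ∈ powerHypographCone p q := fun u hu => by
    rw [hmem]; simp [hu.le]
  rcases hθ'.eq_or_lt with rfl | hlt
  · obtain ⟨h02, h20, h12, h10, h11⟩ := hB.entries_of_half one_ne_zero hK hx
    -- The missing information for `θ = 1/2` comes from this boundary ray, where both outer
    -- coordinates are minimal.
    have hax : (-EuclideanSpace.single 1 1 : E3) ∈ powerHypographCone p q := by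
      rw [hmem]; simp
    have h01 : entry B 0 1 = 0 := by
      have := hB.apply_eq_zero (i := 0) (fun x hx => ((hmem x).1 hx).2.1) hax (by simp)
      simpa [entry] using this
    have h21 : entry B 2 1 = 0 := by
      have := hB.apply_eq_zero (i := 2) (fun x hx => ((hmem x).1 hx).2.2) hax (by simp)
      simpa [entry] using this
    rw [h01] at h12
    rw [h21] at h10
    exact ⟨h01, by linarith, by linarith, by linarith, by linarith, h21, by linarith⟩
  · exact hB.entries_of_lt_half one_ne_zero hK hx hθ hlt one_ne_zero

theorem isRigid_halfPowerCone (hp : 2 ≤ p) (hpq : 1 / p + 1 / q = 1) :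
    IsRigid (halfPowerCone p q) (1 / p) := by
  obtain ⟨-, hθ, hθ'⟩ := powerExponents hp hpq
  have hmem := mem_halfPowerCone hp hpq
  refine isRigid_of_entries fun B hB => ?_
  generalize 1 / p = θ at hθ hθ' hmem ⊢
  have hK : ∀ x ∈ halfPowerCone p q, 0 < x 0 → 0 < x 2 →
      0 ≤ 1 * (1 * (x 0 ^ θ * x 2 ^ (1 - θ)) - x 1) := fun x hx _ _ => by
    rw [hmem] at hx; linarith [hx.2.1]
  have hx : ∀ u : ℝ, 0 < u → !₂[u, 1 * u ^ θ, 1] ∈ halfPowerCone p q := fun u hu => by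
    rw [hmem]; simp [hu.le]; positivity
  rcases hθ'.eq_or_lt with rfl | hlt
  · obtain ⟨h02, h20, h12, h10, h11⟩ := hB.entries_of_half one_ne_zero hK hx
    -- The flat lower face is the boundary surface with `β = 0`.
    obtain ⟨-, -, h12', h10', -⟩ := hB.entries_of_half (σ := -1) (β := 0) (by norm_num)
      (fun x hx _ _ => by rw [hmem] at hx; linarith [hx.1])
      (fun u hu => by rw [hmem]; simp [hu.le]; positivity)
    exact ⟨by linarith, by linarith, by linarith, by linarith, by linarith, by linarith,
      by linarith⟩
  · exact hB.entries_of_lt_half one_ne_zero hK hx hθ hlt one_ne_zero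

theorem isRigid_powerCone (hp : 2 ≤ p) (hpq : 1 / p + 1 / q = 1) (hα : 0 < α) (hα' : α ≤ 1)
    (hne : ¬(p = 2 ∧ α = 1)) : IsRigid (powerCone p q α) (1 / p) := by
  obtain ⟨-, hθ, hθ'⟩ := powerExponents hp hpq
  have hmem := mem_powerCone (α := α) hp hpq
  have hne' : 1 / p = 1 / 2 → α ≠ 1 := fun h hα1 => hne ⟨by
    rwa [one_div, one_div, inv_inj] at h, hα1⟩
  refine isRigid_of_entries fun B hB => ?_
  generalize 1 / p = θ at hθ hθ' hmem hne' ⊢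
  have hK : ∀ x ∈ powerCone p q α, 0 < x 0 → 0 < x 2 →
      0 ≤ 1 * (1 * (x 0 ^ θ * x 2 ^ (1 - θ)) - x 1) := fun x hx _ _ => by
    rw [hmem] at hx; linarith [hx.2.1]
  have hx : ∀ u : ℝ, 0 < u → !₂[u, 1 * u ^ θ, 1] ∈ powerCone p q α := fun u hu => by
    have : 0 < u ^ θ := by positivity
    rw [hmem]; simp [hu.le]; nlinarith
  rcases hθ'.eq_or_lt with rfl | hlt
  · have hα1 := hne' rfl
    obtain ⟨h02, h20, h12, h10, h11⟩ := hB.entries_of_half one_ne_zero hK hx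
    -- The lower boundary has `β = -α`. Its relations differ from the upper ones by the factor `α²`,
    -- which decouples the entries unless `α = 1`, the quadratic cone.
    obtain ⟨-, -, h12', h10', -⟩ := hB.entries_of_half (σ := -1) (β := -α) (by norm_num)
      (fun x hx _ _ => by rw [hmem] at hx; linarith [hx.1])
      (fun u hu => by
        have : 0 < u ^ (1 / 2 : ℝ) := by positivity
        rw [hmem]; simp [hu.le] at this ⊢; nlinarith)
    have hα2 : (1 - α ^ 2) ≠ 0 := by
      intro h
      exact hα1 (by nlinarith)
    have h01 : entry B 0 1 = 0 := by
      refine (mul_eq_zero.1 (?_ : (1 - α ^ 2) * entry B 0 1 = 0)).resolve_left hα2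
      linarith
    have h21 : entry B 2 1 = 0 := by
      refine (mul_eq_zero.1 (?_ : (1 - α ^ 2) * entry B 2 1 = 0)).resolve_left hα2
      linarith
    rw [h01] at h12
    rw [h21] at h10
    exact ⟨h01, by linarith, by linarith, by linarith, by linarith, h21, by linarith⟩
  · exact hB.entries_of_lt_half one_ne_zero hK hx hθ hlt one_ne_zero

/-- The generator of a flow on the homogenized epigraph of the exponential function. -/
def expShift : E3 →ₗ[ℝ] E3 where
  toFun x := !₂[x 2, x 1, 0]
  map_add' x y := by ext i; fin_cases i <;> simp
  map_smul' r x := by ext i; fin_cases i <;> simp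

theorem flowTangent_expShift : FlowTangent expEpigraphCone expShift := by
  intro x hx
  refine ⟨fun t => !₂[x 0 + t * x 2, Real.exp t * x 1, x 2], fun t => ?_, ?_, ?_⟩
  · rcases hx with ⟨h0, h1, h2⟩ | ⟨h1, h2⟩
    · left
      refine ⟨?_, mul_nonneg (Real.exp_pos _).le h1, h2⟩
      simp [h2, h0]
    · right
      refine ⟨?_, h2⟩
      simp only [Matrix.cons_val]
      have e : (x 0 + t * x 2) / x 2 = t + x 0 / x 2 := by field_simp; ring
      rw [e, Real.exp_add, mul_div_assoc]
      gcongr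
  · exact vec_ext (by simp) (by simp) (by simp)
  · have h2 : HasDerivAt Real.exp 1 0 := by simpa using Real.hasDerivAt_exp 0
    have h1 : HasDerivAt (fun t : ℝ => x 0 + t * x 2) (x 2) 0 := by
      simpa using ((hasDerivAt_id (0 : ℝ)).mul_const (x 2)).const_add (x 0)
    convert hasDerivAt_vec h1 (h2.mul_const (x 1)) (hasDerivAt_const 0 (x 2)) using 1
    simp [expShift]

/-- `expShift` sends `e₃` to `e₁` and `e₁` to 0; such a Jordan chain has no diagonal conjugate. -/
theorem not_coneIsomorphic_of_hasDiagonalFlows {K : Set E3} (hK : HasDiagonalFlows K) :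
    ¬ConeIsomorphic expEpigraphCone K := by
  rintro ⟨S, hS⟩
  obtain ⟨i, hi⟩ := exists_coord_ne (x := S (EuclideanSpace.single 0 1)) (by simp)
  have h0 := hK.coord_eq hS flowTangent_expShift (EuclideanSpace.single 0 1) i
  have h2 := hK.coord_eq hS flowTangent_expShift (EuclideanSpace.single 2 1) i
  have e0 : expShift (EuclideanSpace.single 0 1) = 0 := by
    refine vec_ext ?_ ?_ ?_ <;> simp [expShift]
  have e2 : expShift (EuclideanSpace.single 2 1) = EuclideanSpace.single 0 1 := by
    refine vec_ext ?_ ?_ ?_ <;> simp [expShift]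
  rw [e0, map_zero, PiLp.zero_apply] at h0
  have hz := (mul_eq_zero.1 h0).resolve_right hi
  rw [hz, e2, zero_mul] at h2
  exact hi h2.symm

end Lists

/-! ### Strict convexity of the quadratic cone -/

theorem ConeIsomorphic.symm {K L : Set E3} (h : ConeIsomorphic K L) : ConeIsomorphic L K := by
  obtain ⟨S, rfl⟩ := h
  exact ⟨S.symm, by simp [Set.image_image]⟩

theorem ConeIsomorphic.trans {K L M : Set E3} (h : ConeIsomorphic K L) (h' : ConeIsomorphic L M) :
    ConeIsomorphic K M := by
  obtain ⟨S, rfl⟩ := h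
  obtain ⟨S', rfl⟩ := h'
  exact ⟨S.trans S', by rw [Set.image_image]; rfl⟩

/-- Strict convexity of the quadratic cone. -/
theorem add_mem_interior_quadratic {a b : E3} (ha : a ∈ powerCone 2 2 1) (hb : b ∈ powerCone 2 2 1)
    (hab : ∀ s t : ℝ, s • a + t • b = 0 → s = 0 ∧ t = 0) :
    0 < (a + b) 0 ∧ 0 < (a + b) 2 ∧ (a + b) 1 ^ 2 < (a + b) 0 * (a + b) 2 := by
  rw [mem_powerCone_two_iff] at ha hb
  obtain ⟨ha0, ha2, ha1⟩ := ha
  obtain ⟨hb0, hb2, hb1⟩ := hb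
  -- The polar form of `x₁x₃ - x₂²` is nonnegative on the cone. The value of the form at `a + b` is
  -- its values at `a` and `b` plus this term, so in the case of equality all three vanish.
  have hR : 0 ≤ a 0 * b 2 + a 2 * b 0 - 2 * (a 1 * b 1) := by
    have h1 : (a 1 * b 1) ^ 2 ≤ (a 0 * a 2) * (b 0 * b 2) := by
      rw [mul_pow]
      exact mul_le_mul ha1 hb1 (sq_nonneg _) (mul_nonneg ha0 ha2)
    have h2 : (2 * (a 1 * b 1)) ^ 2 ≤ (a 0 * b 2 + a 2 * b 0) ^ 2 := by
      nlinarith [sq_nonneg (a 0 * b 2 - a 2 * b 0)]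
    have := abs_le_of_sq_le_sq' h2 (by positivity)
    linarith [this.2]
  have hstrict : (a + b) 1 ^ 2 < (a + b) 0 * (a + b) 2 := by
    simp only [PiLp.add_apply]
    by_contra hcon
    have hR0 : a 0 * b 2 + a 2 * b 0 = 2 * (a 1 * b 1) := by nlinarith
    have hP0 : a 1 ^ 2 = a 0 * a 2 := by nlinarith
    have hQ0 : b 1 ^ 2 = b 0 * b 2 := by nlinarith
    -- Equality makes all 2×2 minors of `a, b` vanish, contradicting independence.
    have e01 : b 0 * a 1 - a 0 * b 1 = 0 := by
      refine pow_eq_zero_iff two_ne_zero |>.1 ?_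
      linear_combination (b 0) ^ 2 * hP0 + (a 0) ^ 2 * hQ0 + a 0 * b 0 * hR0
    have e21 : b 2 * a 1 - a 2 * b 1 = 0 := by
      refine pow_eq_zero_iff two_ne_zero |>.1 ?_
      linear_combination (b 2) ^ 2 * hP0 + (a 2) ^ 2 * hQ0 + a 2 * b 2 * hR0
    have e02 : b 0 * a 2 - a 0 * b 2 = 0 := by
      refine pow_eq_zero_iff two_ne_zero |>.1 ?_
      linear_combination (a 0 * b 2 + a 2 * b 0 + 2 * (a 1 * b 1)) * hR0 +
        4 * (b 1) ^ 2 * hP0 + 4 * (a 0 * a 2) * hQ0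
    have h0 := hab (b 0) (-a 0) (vec_ext (by simp; ring) (by simp; linarith) (by simp; linarith))
    have h2 := hab (b 2) (-a 2) (vec_ext (by simp; linarith) (by simp; linarith) (by simp; ring))
    have ha00 : a 0 = 0 := by linarith [h0.2]
    have ha20 : a 2 = 0 := by linarith [h2.2]
    have ha10 : a 1 = 0 := by
      refine pow_eq_zero_iff two_ne_zero |>.1 ?_
      rw [hP0, ha00, zero_mul]
    have := hab 1 0 (vec_ext (by simp [ha00]) (by simp [ha10]) (by simp [ha20]))
    exact one_ne_zero this.1
  have h0 : 0 ≤ (a + b) 0 := add_nonneg ha0 hb0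
  have h2 : 0 ≤ (a + b) 2 := add_nonneg ha2 hb2
  have hpos : 0 < (a + b) 0 * (a + b) 2 := lt_of_le_of_lt (sq_nonneg _) hstrict
  exact ⟨pos_of_mul_pos_left hpos h2, pos_of_mul_pos_right hpos h0, hstrict⟩

/-- A cone with a two-dimensional face is not a quadratic cone. -/
theorem not_coneIsomorphic_quadratic {K : Set E3} (hK : ∀ x ∈ K, 0 ≤ x 2) {a b : E3} (ha : a ∈ K)
    (hb : b ∈ K) (ha2 : a 2 = 0) (hb2 : b 2 = 0)
    (hab : ∀ s t : ℝ, s • a + t • b = 0 → s = 0 ∧ t = 0) :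
    ¬ConeIsomorphic K (powerCone 2 2 1) := by
  rintro ⟨S, hS⟩
  have hmem : ∀ x, S x ∈ powerCone 2 2 1 ↔ x ∈ K := fun x => by
    rw [← hS]
    exact S.injective.mem_set_image
  obtain ⟨h0, h2, h1⟩ := add_mem_interior_quadratic ((hmem a).2 ha) ((hmem b).2 hb)
    (fun s t h => hab s t (by
      rw [← map_smul, ← map_smul, ← map_add] at h
      exact S.map_eq_zero_iff.1 h))
  -- The image of `a + b` is interior to the quadratic cone, so a small push out of the face `x₃ =
  -- 0` would remain in `K`, where `x₃ ≥ 0`.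
  set F : ℝ → E3 := fun ε => S (a + b - ε • EuclideanSpace.single 2 1) with hF
  have hFc : Continuous F := by fun_prop
  have hF0 : F 0 = S a + S b := by simp [hF]
  have hc : ∀ i, Continuous fun ε => F ε i := fun i => by fun_prop
  rw [← hF0] at h0 h1 h2
  have hev : ∀ᶠ ε in 𝓝[>] (0 : ℝ), 0 < F ε 0 ∧ 0 < F ε 2 ∧ F ε 1 ^ 2 < F ε 0 * F ε 2 := by
    refine Filter.Eventually.filter_mono nhdsWithin_le_nhds ?_
    refine ((hc 0).continuousAt.eventually_const_lt h0).and
      (((hc 2).continuousAt.eventually_const_lt h2).and ?_)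
    exact ((hc 1).pow 2).continuousAt.eventually_lt ((hc 0).mul (hc 2)).continuousAt h1
  obtain ⟨ε, ⟨hε0, hε2, hε1⟩, hε⟩ := (hev.and self_mem_nhdsWithin).exists
  have hmemK := (hmem _).1 ((mem_powerCone_two_iff (F ε)).2 ⟨hε0.le, hε2.le, hε1.le⟩)
  have := hK _ hmemK
  simp [ha2, hb2] at this
  exact absurd hε (not_lt.2 this)

theorem not_coneIsomorphic_orthant_quadratic :
    ¬ConeIsomorphic orthantCone (powerCone 2 2 1) := by
  refine not_coneIsomorphic_quadratic (fun x hx => hx.2.2) (a := EuclideanSpace.single 0 1)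
    (b := EuclideanSpace.single 1 1) ?_ ?_ (by simp) (by simp) fun s t h => ⟨?_, ?_⟩
  · refine ⟨?_, ?_, ?_⟩ <;> simp
  · refine ⟨?_, ?_, ?_⟩ <;> simp
  · simpa using congrArg (fun x : E3 => x 0) h
  · simpa using congrArg (fun x : E3 => x 1) h

theorem not_coneIsomorphic_expEpigraph_quadratic :
    ¬ConeIsomorphic expEpigraphCone (powerCone 2 2 1) := by
  refine not_coneIsomorphic_quadratic (fun x hx => ?_) (a := -EuclideanSpace.single 0 1)
    (b := EuclideanSpace.single 1 1) ?_ ?_ (by simp) (by simp) fun s t h => ⟨?_, ?_⟩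
  · rcases hx with ⟨-, -, h⟩ | ⟨-, h⟩
    · exact h.ge
    · exact h.le
  · left; refine ⟨?_, ?_, ?_⟩ <;> simp
  · left; refine ⟨?_, ?_, ?_⟩ <;> simp
  · simpa using congrArg (fun x : E3 => x 0) h
  · simpa using congrArg (fun x : E3 => x 1) h

/-! ### Mutual non-isomorphism of the listed cones -/

namespace ConeType

/-- Equality of the first exponents gives equality of both. -/
theorem exponents_eq {p q p' q' : ℝ} (hpq : 1 / p + 1 / q = 1) (hpq' : 1 / p' + 1 / q' = 1)
    (h : 1 / p = 1 / p') : p = p' ∧ q = q' := by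
  have h' : 1 / q = 1 / q' := by linarith
  rw [one_div, one_div, inv_inj] at h h'
  exact ⟨h, h'⟩

/-- The profile `[-α, 1]` is bounded and has 0 in its interior; among the other families, the
profiles are unbounded or end at 0. -/
theorem eq_power {c : ConeType} {p q α : ℝ} {hp : 2 ≤ p} {hpq : 1 / p + 1 / q = 1} {hα : 0 < α}
    {hα' : α ≤ 1} (hne : ¬(p = 2 ∧ α = 1))
    (h : ConeIsomorphic c.cone (power p q α hp hpq hα hα').cone) :
    c = power p q α hp hpq hα hα' := by
  have hR := isRigid_powerCone hp hpq hα hα' hne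
  have hP := hasProfile_powerCone (α := α) hp hpq
  obtain ⟨-, h1, h2⟩ := powerExponents hp hpq
  cases c with
  | expEpigraph => exact absurd h (not_coneIsomorphic_of_hasDiagonalFlows hR.1)
  | orthant =>
    obtain ⟨S, hS⟩ := h
    obtain ⟨-, k, hk, hI⟩ := (hasProfile_orthantCone (1 / p)).eq_of_image hP hR hS
      ⟨0, by simp⟩ h1 h2 h1 h2
    exfalso
    have h3 := (hI (2 / |k|)).1 (by rw [Set.mem_Ici]; positivity)
    rcases lt_or_gt_of_ne hk with hlt | hgt
    · rw [abs_of_neg hlt, Set.mem_Icc] at h3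
      have : k * (2 / -k) = -2 := by field_simp
      linarith [h3.1]
    · rw [abs_of_pos hgt, Set.mem_Icc] at h3
      have : k * (2 / k) = 2 := by field_simp
      linarith [h3.2]
  | powerHypograph p' q' hp' hpq' =>
    obtain ⟨-, h1', h2'⟩ := powerExponents hp' hpq'
    obtain ⟨S, hS⟩ := h
    obtain ⟨-, k, hk, hI⟩ := (hasProfile_powerHypographCone hp' hpq').eq_of_image hP hR hS
      ⟨0, by simp⟩ h1' h2' h1 h2
    exfalso
    have h3 := (hI (-2 / |k|)).1 (by
      rw [Set.mem_Iic, neg_div]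
      have : 0 ≤ 2 / |k| := by positivity
      linarith)
    rcases lt_or_gt_of_ne hk with hlt | hgt
    · rw [abs_of_neg hlt, Set.mem_Icc] at h3
      have : k * (-2 / -k) = 2 := by field_simp
      linarith [h3.2]
    · rw [abs_of_pos hgt, Set.mem_Icc] at h3
      have : k * (-2 / k) = -2 := by field_simp
      linarith [h3.1]
  | power p' q' α' hp' hpq' hα0 hα1 =>
    obtain ⟨-, h1', h2'⟩ := powerExponents hp' hpq'
    obtain ⟨S, hS⟩ := h
    obtain ⟨hθ, k, hk, hI⟩ := (hasProfile_powerCone (α := α') hp' hpq').eq_of_image hP hR hS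
      ⟨0, by simp [hα0.le]⟩ h1' h2' h1 h2
    obtain ⟨rfl, rfl⟩ := exponents_eq hpq' hpq hθ
    suffices α' = α by subst this; rfl
    simp only [Set.mem_Icc] at hI
    have i1 := (hI 1).1 ⟨by linarith, le_rfl⟩
    have i2 := (hI (-α')).1 ⟨le_rfl, by linarith⟩
    -- Scaling by `k` must match endpoints. For `k > 0` this gives `k = 1`; for `k < 0` the ends are
    -- exchanged, so `αα' = 1` and both equal 1.
    have i3 := (hI (1 / k)).2 (by rw [mul_one_div_cancel hk]; constructor <;> linarith)
    have i4 := (hI (-α / k)).2 (by rw [mul_div_cancel₀ _ hk]; constructor <;> linarith)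
    rcases lt_or_gt_of_ne hk with hlt | hgt
    · rw [le_div_iff_of_neg hlt, div_le_iff_of_neg hlt] at i3 i4
      nlinarith
    · rw [le_div_iff₀ hgt, div_le_iff₀ hgt] at i3 i4
      nlinarith
  | halfPower p' q' hp' hpq' =>
    obtain ⟨-, h1', h2'⟩ := powerExponents hp' hpq'
    obtain ⟨S, hS⟩ := h
    obtain ⟨-, k, hk, hI⟩ := (hasProfile_halfPowerCone hp' hpq').eq_of_image hP hR hS
      ⟨0, by simp⟩ h1' h2' h1 h2
    exfalso
    simp only [Set.mem_Icc] at hI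
    have i3 := (hI (1 / k)).2 (by rw [mul_one_div_cancel hk]; constructor <;> linarith)
    have i4 := (hI (-α / k)).2 (by rw [mul_div_cancel₀ _ hk]; constructor <;> linarith)
    rcases lt_or_gt_of_ne hk with hlt | hgt
    · rw [le_div_iff_of_neg hlt, div_le_iff_of_neg hlt] at i3
      linarith [i3.1]
    · rw [le_div_iff₀ hgt, div_le_iff₀ hgt] at i4
      linarith [i4.1]

/-- The half-line `(-∞, 1]` has 0 in its interior, which excludes multiples of `[0, ∞)`, and it is
unbounded, which excludes the intervals. -/
theorem eq_powerHypograph {c : ConeType} {p q : ℝ} {hp : 2 ≤ p} {hpq : 1 / p + 1 / q = 1}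
    (h : ConeIsomorphic c.cone (powerHypograph p q hp hpq).cone) :
    c = powerHypograph p q hp hpq := by
  have hR := isRigid_powerHypographCone hp hpq
  have hP := hasProfile_powerHypographCone hp hpq
  obtain ⟨-, h1, h2⟩ := powerExponents hp hpq
  cases c with
  | expEpigraph => exact absurd h (not_coneIsomorphic_of_hasDiagonalFlows hR.1)
  | orthant =>
    obtain ⟨S, hS⟩ := h
    obtain ⟨-, k, hk, hI⟩ := (hasProfile_orthantCone (1 / p)).eq_of_image hP hR hS
      ⟨0, by simp⟩ h1 h2 h1 h2
    exfalso
    simp only [Set.mem_Ici, Set.mem_Iic] at hI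
    have i3 := (hI (1 / k)).2 (by rw [mul_one_div_cancel hk])
    have i4 := (hI (-1 / k)).2 (by rw [mul_div_cancel₀ _ hk]; norm_num)
    rw [neg_div] at i4
    have : 1 / k ≠ 0 := one_div_ne_zero hk
    exact this (by linarith)
  | powerHypograph p' q' hp' hpq' =>
    obtain ⟨-, h1', h2'⟩ := powerExponents hp' hpq'
    obtain ⟨S, hS⟩ := h
    obtain ⟨hθ, -⟩ := (hasProfile_powerHypographCone hp' hpq').eq_of_image hP hR hS
      ⟨0, by simp⟩ h1' h2' h1 h2
    obtain ⟨rfl, rfl⟩ := exponents_eq hpq' hpq hθ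
    rfl
  | power p' q' α hp' hpq' hα hα' =>
    obtain ⟨-, h1', h2'⟩ := powerExponents hp' hpq'
    obtain ⟨S, hS⟩ := h
    obtain ⟨-, k, hk, hI⟩ := (hasProfile_powerCone (α := α) hp' hpq').eq_of_image hP hR hS
      ⟨0, by simp [hα.le]⟩ h1' h2' h1 h2
    exfalso
    simp only [Set.mem_Icc, Set.mem_Iic] at hI
    rcases lt_or_gt_of_ne hk with hlt | hgt
    · have := (hI 2).2 (by linarith)
      linarith [this.2]
    · have := (hI (-2)).2 (by linarith)
      linarith [this.1]
  | halfPower p' q' hp' hpq' =>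
    obtain ⟨-, h1', h2'⟩ := powerExponents hp' hpq'
    obtain ⟨S, hS⟩ := h
    obtain ⟨-, k, hk, hI⟩ := (hasProfile_halfPowerCone hp' hpq').eq_of_image hP hR hS
      ⟨0, by simp⟩ h1' h2' h1 h2
    exfalso
    simp only [Set.mem_Icc, Set.mem_Iic] at hI
    rcases lt_or_gt_of_ne hk with hlt | hgt
    · have := (hI 2).2 (by linarith)
      linarith [this.2]
    · have := (hI (-2)).2 (by linarith)
      linarith [this.1]

/-- The profile `[0, 1]` is bounded with end 0, so it is a multiple neither of `[0, ∞)` nor of `[-α,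
1]`. -/
theorem eq_halfPower {c : ConeType} {p q : ℝ} {hp : 2 ≤ p} {hpq : 1 / p + 1 / q = 1}
    (h : ConeIsomorphic c.cone (halfPower p q hp hpq).cone) :
    c = halfPower p q hp hpq := by
  have hR := isRigid_halfPowerCone hp hpq
  have hP := hasProfile_halfPowerCone hp hpq
  obtain ⟨-, h1, h2⟩ := powerExponents hp hpq
  cases c with
  | expEpigraph => exact absurd h (not_coneIsomorphic_of_hasDiagonalFlows hR.1)
  | orthant =>
    obtain ⟨S, hS⟩ := h
    obtain ⟨-, k, hk, hI⟩ := (hasProfile_orthantCone (1 / p)).eq_of_image hP hR hS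
      ⟨0, by simp⟩ h1 h2 h1 h2
    exfalso
    have h3 := (hI (2 / |k|)).1 (by rw [Set.mem_Ici]; positivity)
    rcases lt_or_gt_of_ne hk with hlt | hgt
    · rw [abs_of_neg hlt, Set.mem_Icc] at h3
      have : k * (2 / -k) = -2 := by field_simp
      linarith [h3.1]
    · rw [abs_of_pos hgt, Set.mem_Icc] at h3
      have : k * (2 / k) = 2 := by field_simp
      linarith [h3.2]
  | powerHypograph p' q' hp' hpq' => exact absurd (eq_powerHypograph h.symm) (by simp)
  | power p' q' α hp' hpq' hα hα' =>
    obtain ⟨-, h1', h2'⟩ := powerExponents hp' hpq'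
    obtain ⟨S, hS⟩ := h
    obtain ⟨-, k, hk, hI⟩ := (hasProfile_powerCone (α := α) hp' hpq').eq_of_image hP hR hS
      ⟨0, by simp [hα.le]⟩ h1' h2' h1 h2
    exfalso
    simp only [Set.mem_Icc] at hI
    have i1 := (hI 1).1 ⟨by linarith, le_rfl⟩
    have i2 := (hI (-α)).1 ⟨le_rfl, by linarith⟩
    rcases lt_or_gt_of_ne hk with hlt | hgt
    · linarith [i1.1]
    · nlinarith [i2.1, mul_pos hgt hα]
  | halfPower p' q' hp' hpq' =>
    obtain ⟨-, h1', h2'⟩ := powerExponents hp' hpq'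
    obtain ⟨S, hS⟩ := h
    obtain ⟨hθ, -⟩ := (hasProfile_halfPowerCone hp' hpq').eq_of_image hP hR hS
      ⟨0, by simp⟩ h1' h2' h1 h2
    obtain ⟨rfl, rfl⟩ := exponents_eq hpq' hpq hθ
    rfl

/-- The listed cones are mutually non-isomorphic. -/
theorem eq_of_coneIsomorphic (c c' : ConeType) (h : ConeIsomorphic c.cone c'.cone) : c = c' := by
  have hquad : ∀ {p q α : ℝ}, p = 2 ∧ α = 1 → 1 / p + 1 / q = 1 → p = 2 ∧ q = 2 ∧ α = 1 := by
    rintro p q α ⟨rfl, rfl⟩ hpq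
    refine ⟨rfl, ?_, rfl⟩
    have h' : 1 / q = 1 / 2 := by linarith
    rwa [one_div, one_div, inv_inj] at h'
  cases c' with
  | powerHypograph => exact eq_powerHypograph h
  | halfPower => exact eq_halfPower h
  | power p' q' α' hp' hpq' hα hα' =>
    -- The quadratic cone is not rigid. Against a rigid power cone the isomorphism is inverted to
    -- make the rigid one the target; strict convexity handles the orthant and the exponential cone.
    by_cases hne' : p' = 2 ∧ α' = 1
    swap
    · exact eq_power hne' h
    obtain ⟨rfl, rfl, rfl⟩ := hquad hne' hpq'
    cases c with
    | powerHypograph => exact (eq_powerHypograph h.symm).symm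
    | halfPower => exact (eq_halfPower h.symm).symm
    | power p q α hp hpq =>
      by_cases hne : p = 2 ∧ α = 1
      · obtain ⟨rfl, rfl, rfl⟩ := hquad hne hpq
        rfl
      · exact (eq_power hne h.symm).symm
    | expEpigraph => exact absurd h not_coneIsomorphic_expEpigraph_quadratic
    | orthant => exact absurd h not_coneIsomorphic_orthant_quadratic
  | expEpigraph =>
    cases c with
    | powerHypograph => exact (eq_powerHypograph h.symm).symm
    | halfPower => exact (eq_halfPower h.symm).symm
    | power p q α hp hpq =>
      by_cases hne : p = 2 ∧ α = 1
      · obtain ⟨rfl, rfl, rfl⟩ := hquad hne hpq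
        exact absurd h.symm not_coneIsomorphic_expEpigraph_quadratic
      · exact (eq_power hne h.symm).symm
    | expEpigraph => rfl
    | orthant =>
      exact absurd h.symm (not_coneIsomorphic_of_hasDiagonalFlows hasDiagonalFlows_orthantCone)
  | orthant =>
    cases c with
    | powerHypograph => exact (eq_powerHypograph h.symm).symm
    | halfPower => exact (eq_halfPower h.symm).symm
    | power p q α hp hpq =>
      by_cases hne : p = 2 ∧ α = 1
      · obtain ⟨rfl, rfl, rfl⟩ := hquad hne hpq
        exact absurd h.symm not_coneIsomorphic_orthant_quadratic
      · exact (eq_power hne h.symm).symm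
    | expEpigraph =>
      exact absurd h (not_coneIsomorphic_of_hasDiagonalFlows hasDiagonalFlows_orthantCone)
    | orthant => rfl

end ConeType

theorem theorem2 :
    (∀ (K : Set E3) (hK : IsRegularConvexCone K), 2 ≤ coneAutDim K hK.isClosed →
      ∃! c : ConeType, ConeIsomorphic K c.cone) ∧
    (∀ c c' : ConeType, ConeIsomorphic c.cone c'.cone → c = c') := by
  refine ⟨fun K hK hdim => ?_, ConeType.eq_of_coneIsomorphic⟩
  obtain ⟨A, hA, hsc⟩ := exists_nonscalar_of_two_le hdim
  obtain ⟨c, hc⟩ := hK.exists_listed hA hsc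
  exact ⟨c, hc, fun c' hc' => ConeType.eq_of_coneIsomorphic _ _ (hc'.symm.trans hc)⟩
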